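/- Let $1\le k<n$ be integers, let $\Omega\subset\mathbb C^n$ be an open set containing $0$, let $R>0$ be such that $\overline\Omega\subset B_R=\{|z|<R\}$, put $\Sigma_R=B_R\setminus\overline\Omega$, and let $\varepsilon>0$. For a real $C^2$ function $u$ let $S_i(\partial\bar\partial u)$ be the $i$-th elementary symmetric function of the eigenvalues of the complex Hessian $(\partial^2u/\partial z_i\partial\bar z_j)$, and $H_k(u)=S_k(\partial\bar\partial u)$. Set $$w^\varepsilon(z)=-\Big(\frac{|z|^2+\varepsilon^2}{1+\varepsilon^2}\Big)^{1-\frac nk},\qquad f^\varepsilon(z)=\binom nk\Big(\frac nk-1\Big)^k\varepsilon^2(1+\varepsilon^2)^{n-k}(|z|^2+\varepsilon^2)^{-n-1}\ \ (=H_k(w^\varepsilon)).$$ Let $u\in C^\infty(\overline{\Sigma_R})$ (that is, $u$ is real and smooth in a neighbourhood of $\overline{\Sigma_R}$) be a strictly $k$-subharmonic solution, i.e. $S_i(\partial\bar\partial u)>0$ in $\Sigma_R$ for $1\le i\le k$, of $$H_k(u)=f^\varepsilon\ \text{ in }\Sigma_R,\qquad u=-1\ \text{ on }\partial\Omega,\qquad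 u=w^\varepsilon\ \text{ on }\partial B_R .$$ Write $|Dg|^2=\sum_{i=1}^n|\partial g/\partial z_i|^2$ for real functions $g$. Then $u<0$ on $\overline{\Sigma_R}$, and for $$P=|Du|^2(-u)^{-\frac{2n-k}{n-k}}$$ the following maxima exist and satisfy $$\max_{\overline{\Sigma_R}}P\le\max\Big\{\max_{\partial\Sigma_R}P,\ \max_{\overline{\Sigma_R}}\Big(\frac{2(n-k)}{k(2n-k)}\Big)^2(-u)^{-\frac k{n-k}}|D\log f^\varepsilon|^2\Big\}.$$ -/

import Mathlib

open scoped ContDiff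

noncomputable section

namespace KHessian

/-- The Wirtinger derivative `∂g/∂z_i = (∂g/∂x_i - √-1 ∂g/∂y_i) / 2` of `g : ℂⁿ → ℂ`. -/
def dz {n : ℕ} (i : Fin n) (g : EuclideanSpace ℂ (Fin n) → ℂ) (z : EuclideanSpace ℂ (Fin n)) : ℂ :=
  (fderiv ℝ g z (EuclideanSpace.single i 1)
    - Complex.I * fderiv ℝ g z (EuclideanSpace.single i Complex.I)) / 2

/-- The Wirtinger derivative `∂g/∂z̄_j = (∂g/∂x_j + √-1 ∂g/∂y_j) / 2` of `g : ℂⁿ → ℂ`. -/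
def dzbar {n : ℕ} (j : Fin n) (g : EuclideanSpace ℂ (Fin n) → ℂ) (z : EuclideanSpace ℂ (Fin n)) :
    ℂ :=
  (fderiv ℝ g z (EuclideanSpace.single j 1)
    + Complex.I * fderiv ℝ g z (EuclideanSpace.single j Complex.I)) / 2

/-- The complex Hessian `(∂²u/∂z_i∂z̄_j)` of a real function `u` on `ℂⁿ`. -/
def complexHessian {n : ℕ} (u : EuclideanSpace ℂ (Fin n) → ℝ) (z : EuclideanSpace ℂ (Fin n)) :
    Matrix (Fin n) (Fin n) ℂ :=
  Matrix.of fun i j => dz i (dzbar j fun w => (u w : ℂ)) z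

/-- The eigenvalues `λ = (λ_1, …, λ_n)` of the complex Hessian, with multiplicity. For a `C²`
function the complex Hessian is Hermitian, so the roots of its characteristic polynomial are real
and taking real parts only changes the type. -/
def hessianEigenvalues {n : ℕ} (u : EuclideanSpace ℂ (Fin n) → ℝ) (z : EuclideanSpace ℂ (Fin n)) :
    Multiset ℝ :=
  (complexHessian u z).charpoly.roots.map Complex.re

/-- The complex `k`-Hessian operator: the `k`-th elementary symmetric function `S_k(λ)` of the
eigenvalues of the complex Hessian. -/
def hessianOp {n : ℕ} (k : ℕ) (u : EuclideanSpace ℂ (Fin n) → ℝ) (z : EuclideanSpace ℂ (Fin n)) :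
    ℝ :=
  (hessianEigenvalues u z).esymm k

/-- `u` is strictly `k`-subharmonic on `U` (for `u` of class `C²`): at every point of `U` the
eigenvalues of the complex Hessian lie in `Γ_k = {λ | S_i(λ) > 0, 1 ≤ i ≤ k}`. -/
def StrictlySubharmonicOn {n : ℕ} (k : ℕ) (u : EuclideanSpace ℂ (Fin n) → ℝ)
    (U : Set (EuclideanSpace ℂ (Fin n))) : Prop :=
  ∀ z ∈ U, ∀ i : ℕ, 1 ≤ i → i ≤ k → 0 < (hessianEigenvalues u z).esymm i

/-- `|Du|² = ∑_i |∂u/∂z_i|²`. -/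
def gradSq {n : ℕ} (u : EuclideanSpace ℂ (Fin n) → ℝ) (z : EuclideanSpace ℂ (Fin n)) : ℝ :=
  ∑ i : Fin n, ‖dz i (fun w => (u w : ℂ)) z‖ ^ 2

/-- `w^ε(z) = -((|z|² + ε²) / (1 + ε²))^(1 - n/k)`, the approximation of the Green function. -/
def approxGreen {n : ℕ} (k : ℕ) (ε : ℝ) (z : EuclideanSpace ℂ (Fin n)) : ℝ :=
  -((‖z‖ ^ 2 + ε ^ 2) / (1 + ε ^ 2)) ^ (1 - (n : ℝ) / (k : ℝ))

/-- `f^ε(z) = C(n,k) (n/k - 1)^k ε² (1 + ε²)^(n-k) (|z|² + ε²)^(-n-1)`, which is `H_k(w^ε)`. -/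
def approxRhs {n : ℕ} (k : ℕ) (ε : ℝ) (z : EuclideanSpace ℂ (Fin n)) : ℝ :=
  (n.choose k : ℝ) * ((n : ℝ) / (k : ℝ) - 1) ^ k * ε ^ 2 * (1 + ε ^ 2) ^ (n - k)
    * ((‖z‖ ^ 2 + ε ^ 2) ^ (n + 1))⁻¹

/-- `Σ_R = B_R \ closure Ω`. -/
def ringDomain {n : ℕ} (Ω : Set (EuclideanSpace ℂ (Fin n))) (R : ℝ) :
    Set (EuclideanSpace ℂ (Fin n)) :=
  Metric.ball 0 R \ closure Ω

/-- `u ∈ C^∞(closure Σ_R)` is a strictly `k`-subharmonic solution of the approximating equation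
`H_k(u) = f^ε` in `Σ_R` with `u = -1` on `∂Ω` and `u = w^ε` on `∂B_R`. -/
structure IsApproxSolution {n : ℕ} (k : ℕ) (Ω : Set (EuclideanSpace ℂ (Fin n))) (R ε : ℝ)
    (u : EuclideanSpace ℂ (Fin n) → ℝ) : Prop where
  smooth : ∃ U : Set (EuclideanSpace ℂ (Fin n)),
    IsOpen U ∧ closure (ringDomain Ω R) ⊆ U ∧ ContDiffOn ℝ ∞ u U
  subharmonic : StrictlySubharmonicOn k u (ringDomain Ω R)
  equation : ∀ z ∈ ringDomain Ω R, hessianOp k u z = approxRhs k ε z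
  inner_boundary : ∀ z ∈ frontier Ω, u z = -1
  outer_boundary : ∀ z ∈ Metric.sphere (0 : EuclideanSpace ℂ (Fin n)) R, u z = approxGreen k ε z

/-- `P = |Du|² (-u)^(-(2n-k)/(n-k))`. -/
def gradQuotient {n : ℕ} (k : ℕ) (u : EuclideanSpace ℂ (Fin n) → ℝ)
    (z : EuclideanSpace ℂ (Fin n)) : ℝ :=
  gradSq u z * (-u z) ^ (-((2 * (n : ℝ) - (k : ℝ)) / ((n : ℝ) - (k : ℝ))))

/-- `(2(n-k) / (k(2n-k)))² (-u)^(-k/(n-k)) |D log f^ε|²`. -/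
def rhsQuotient {n : ℕ} (k : ℕ) (ε : ℝ) (u : EuclideanSpace ℂ (Fin n) → ℝ)
    (z : EuclideanSpace ℂ (Fin n)) : ℝ :=
  (2 * ((n : ℝ) - (k : ℝ)) / ((k : ℝ) * (2 * (n : ℝ) - (k : ℝ)))) ^ 2
    * (-u z) ^ (-((k : ℝ) / ((n : ℝ) - (k : ℝ))))
    * gradSq (fun w : EuclideanSpace ℂ (Fin n) => Real.log (approxRhs k ε w)) z

end KHessian

end

open scoped ContDiff

noncomputable section

/-! The argument is a maximum principle for `P`. Write `G = |Du|²`, `t = -u` and `p = (2n-k)/(n-k)`,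
so that `p - 1 = n/(n-k)`. A maximum of `P` on the boundary needs no work, and one with `G = 0`
means `P = 0`; what remains is an interior maximum with `G > 0`.

A unitary change of coordinates makes the complex Hessian diagonal there, with entries `λ_i`. The
linearised operator is then diagonal with coefficients `F_i = S_{k-1}(λ|i)`, where `λ|i` omits
`λ_i`, and these are positive on `Γ_k`. The critical equation and Cauchy–Schwarz bound `∑_j
|u_{ij}|²` from below by `(pG/t + λ_i)² |u_i|² / G`. Contract the second-order conditions with `F`,
using `∑ F_i λ_i = k f` and, for the third-order terms, the once differentiated equation. This gives
`(p k f / t) √G ≤ 2 |Df|`, provided a quadratic remainder is nonnegative. Squaring, and using `|Df|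
= f |D log f|`, gives the bound (`gradient_bound_of_critical`).

Up to a positive factor the remainder is `∑ |u_i|² (T + F_i (p s² + 2 p λ_i s + λ_i²))` with `s =
G/t` and `T = ∑ λ_j² F_j`. Only indices with `λ_i < 0` can be harmful, and for these `(n/(n-k)) λ_i²
F_i ≤ T` suffices, a constant equal to `p - 1` (`sum_quadratic_nonneg`). That inequality,
`sum_sq_mul_elemSymm_erase_ge`, is the algebraic heart; it follows from Newton's inequality and
positivity in the Gårding cone. The equation is differentiated only once, so concavity of the
operator plays no role. -/

namespace KHessian

/-! ### Real-rooted polynomials and Laguerre's inequality -/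

open Polynomial in
/-- The derivative of a nonconstant real polynomial with only real roots has only real roots. -/
theorem card_roots_derivative_eq {p : ℝ[X]} (hp : p.roots.card = p.natDegree) :
    p.derivative.roots.card = p.derivative.natDegree := by
  -- Rolle: at most one root is lost, counted with multiplicity, while the degree drops by at least
  -- one.
  have h1 := card_roots_le_derivative p
  have h2 := p.derivative.card_roots'
  have h3 : p.derivative.natDegree ≤ p.natDegree - 1 := natDegree_derivative_le p
  omega

open Polynomial in
theorem card_roots_iterate_derivative_eq {p : ℝ[X]} (hp : p.roots.card = p.natDegree) (r : ℕ) :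
    (derivative^[r] p).roots.card = (derivative^[r] p).natDegree := by
  induction r with
  | zero => simpa using hp
  | succ r ih =>
    rw [Function.iterate_succ_apply']
    exact card_roots_derivative_eq ih

open Polynomial in
/-- The three lowest coefficients of `∏ (X - a)` in terms of the power sums of the `1 / a`. -/
theorem coeff_prod_X_sub_C_low (s : Multiset ℝ) (hs : ∀ a ∈ s, a ≠ 0) :
    ∃ e S Q : ℝ, (s.map fun a => X - C a).prod.coeff 0 = e ∧
      (s.map fun a => X - C a).prod.coeff 1 = -e * S ∧
      2 * (s.map fun a => X - C a).prod.coeff 2 = e * (S ^ 2 - Q) ∧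
      ∀ t : ℝ, 0 ≤ Q - 2 * t * S + s.card * t ^ 2 := by
  induction s using Multiset.induction_on with
  | empty => exact ⟨1, 0, 0, by simp, by simp [coeff_one], by simp [coeff_one], by simp⟩
  | cons a s ih =>
    obtain ⟨e, S, Q, h0, h1, h2, h3⟩ := ih fun b hb => hs b (Multiset.mem_cons_of_mem hb)
    have ha : a ≠ 0 := hs a (Multiset.mem_cons_self a s)
    refine ⟨-a * e, S + a⁻¹, Q + a⁻¹ ^ 2, ?_, ?_, ?_, ?_⟩
    · simp [sub_mul, h0]
    · rw [Multiset.map_cons, Multiset.prod_cons, sub_mul, coeff_sub, coeff_C_mul, coeff_X_mul, h0, h1]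
      field_simp
      ring
    · rw [Multiset.map_cons, Multiset.prod_cons, sub_mul, coeff_sub, coeff_C_mul, coeff_X_mul, h1,
        mul_sub, mul_left_comm 2 a, h2]
      field_simp
      ring
    -- The last clause is `∑ (1/a - t)² ≥ 0` expanded: Cauchy–Schwarz in a form that is additive
    -- over the multiset.
    · intro t
      have := h3 t
      push_cast [Multiset.card_cons]
      nlinarith [sq_nonneg (a⁻¹ - t)]

open Polynomial in
/-- Laguerre's inequality at the origin for a real-rooted polynomial. -/
theorem laguerre_inequality_zero {q : ℝ[X]} (hq : q.roots.card = q.natDegree) :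
    2 * (q.natDegree : ℝ) * (q.coeff 0 * q.coeff 2) ≤ ((q.natDegree : ℝ) - 1) * q.coeff 1 ^ 2 := by
  by_cases hd : q.natDegree = 0
  · have h1 : q.coeff 1 = 0 := coeff_eq_zero_of_natDegree_lt (by omega)
    simp [hd, h1]
  have hd1 : (1 : ℝ) ≤ q.natDegree := by exact_mod_cast Nat.one_le_iff_ne_zero.2 hd
  by_cases h0 : q.coeff 0 = 0
  · rw [h0]
    have : 0 ≤ ((q.natDegree : ℝ) - 1) * q.coeff 1 ^ 2 :=
      mul_nonneg (by linarith) (sq_nonneg _)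
    simpa using this
  have hs : ∀ a ∈ q.roots, a ≠ 0 := by
    rintro a ha rfl
    exact h0 (by simpa [coeff_zero_eq_eval_zero] using (mem_roots'.1 ha).2)
  obtain ⟨e, S, Q, h0', h1, h2, h3⟩ := coeff_prod_X_sub_C_low q.roots hs
  have hfac := C_leadingCoeff_mul_prod_multiset_X_sub_C hq
  set c := q.leadingCoeff
  set d : ℝ := (q.natDegree : ℝ)
  have e0 : q.coeff 0 = c * e := by rw [← hfac, coeff_C_mul, h0']
  have e1 : q.coeff 1 = c * (-e * S) := by rw [← hfac, coeff_C_mul, h1]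
  have e2 : 2 * q.coeff 2 = c * (e * (S ^ 2 - Q)) := by rw [← hfac, coeff_C_mul, ← h2]; ring
  have hCS : S ^ 2 ≤ d * Q := by
    -- `t = S / d` minimises the quadratic, and gives Cauchy–Schwarz.
    have := h3 (S / d)
    rw [hq] at this
    change 0 ≤ Q - 2 * (S / d) * S + d * (S / d) ^ 2 at this
    have hmul := mul_nonneg (by linarith : (0 : ℝ) ≤ d) this
    have : d * (Q - 2 * (S / d) * S + d * (S / d) ^ 2) = d * Q - S ^ 2 := by
      field_simp
      ring
    linarith
  have e3 : 2 * d * (q.coeff 0 * q.coeff 2) = d * ((c * e) ^ 2 * (S ^ 2 - Q)) := by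
    rw [e0]; linear_combination d * (c * e) * e2
  rw [e3, e1]
  nlinarith [mul_le_mul_of_nonneg_left hCS (sq_nonneg (c * e))]

/-! ### Elementary symmetric functions and Newton's inequality -/

/-- The `k`-th elementary symmetric function of the numbers `x i`, `i ∈ s`. -/
def elemSymm {ι : Type*} (x : ι → ℝ) (s : Finset ι) (k : ℕ) : ℝ :=
  ∑ t ∈ s.powersetCard k, ∏ i ∈ t, x i

section ElemSymm

variable {ι : Type*} (x : ι → ℝ)

theorem elemSymm_zero (s : Finset ι) : elemSymm x s 0 = 1 := by
  simp [elemSymm]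

theorem elemSymm_eq_zero {s : Finset ι} {k : ℕ} (h : s.card < k) : elemSymm x s k = 0 := by
  simp [elemSymm, Finset.powersetCard_eq_empty.2 h]

theorem elemSymm_one (s : Finset ι) : elemSymm x s 1 = ∑ i ∈ s, x i := by
  simp [elemSymm, Finset.powersetCard_one]

open Polynomial in
/-- **Newton's inequality** for real numbers of arbitrary signs. -/
theorem newton_inequality (s : Finset ι) (j r : ℕ) (hs : s.card = j + 2 + r) :
    ((j : ℝ) + 2) * (r + 2) * (elemSymm x s j * elemSymm x s (j + 2)) ≤
      (j + 1) * (r + 1) * elemSymm x s (j + 1) ^ 2 := by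
  -- After `r` derivatives of `∏ (X + x_i)` a real-rooted polynomial of degree `j + 2` is left. Its
  -- coefficients 0, 1, 2 are `S_{j+2}`, `S_{j+1}`, `S_j` up to factorial factors, so Laguerre's
  -- inequality at 0 applies.
  set p : ℝ[X] := ((s.val.map x).map fun a => X + C a).prod with hp
  have hcard : (s.val.map x).card = j + 2 + r := by simp [hs]
  have hcoeff : ∀ i ≤ j + 2 + r, p.coeff i = elemSymm x s (j + 2 + r - i) := by
    intro i hi
    rw [hp, Multiset.prod_X_add_C_coeff _ (by rw [hcard]; exact hi), hcard, Finset.esymm_map_val]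
    rfl
  have hp' : p = (((s.val.map x).map Neg.neg).map fun a => X - C a).prod := by
    rw [hp, Multiset.map_map _ Neg.neg]
    simp
  have hdeg : p.natDegree = j + 2 + r := by
    rw [hp', natDegree_multiset_prod_X_sub_C_eq_card, Multiset.card_map, hcard]
  have hroots : p.roots.card = p.natDegree := by
    rw [hdeg, hp', roots_multiset_prod_X_sub_C, Multiset.card_map, hcard]
  set q := derivative^[r] p with hq
  have hqr := card_roots_iterate_derivative_eq hroots r
  have hqd : q.natDegree = j + 2 := by
    apply le_antisymm
    · have := natDegree_iterate_derivative p r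
      rw [hdeg] at this
      simpa using this
    · apply le_natDegree_of_ne_zero
      rw [hq, coeff_iterate_derivative, hcoeff _ le_rfl]
      simp [elemSymm_zero, Nat.descFactorial_eq_zero_iff_lt]
  have hL := laguerre_inequality_zero hqr
  rw [← hq, hqd, hq, coeff_iterate_derivative, coeff_iterate_derivative, coeff_iterate_derivative,
    hcoeff _ (by omega), hcoeff _ (by omega), hcoeff _ (by omega)] at hL
  have i0 : j + 2 + r - (0 + r) = j + 2 := by omega
  have i1 : j + 2 + r - (1 + r) = j + 1 := by omega
  have i2 : j + 2 + r - (2 + r) = j := by omega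
  have d0 : (0 + r).descFactorial r = r.factorial := by rw [zero_add, Nat.descFactorial_self]
  have d1 : (1 + r).descFactorial r = (r + 1) * r.factorial := by
    have := Nat.factorial_mul_descFactorial (n := 1 + r) (k := r) (by omega)
    rw [Nat.add_sub_cancel, add_comm 1 r, Nat.factorial_succ r, Nat.factorial_one, one_mul] at this
    rw [add_comm 1 r, this]
  have d2 : 2 * (2 + r).descFactorial r = (r + 2) * ((r + 1) * r.factorial) := by
    have := Nat.factorial_mul_descFactorial (n := 2 + r) (k := r) (by omega)
    rw [Nat.add_sub_cancel, add_comm 2 r, Nat.factorial_succ (r + 1), Nat.factorial_succ r,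
      Nat.factorial_two] at this
    rw [add_comm 2 r, this]
  have d2' : 2 * ((2 + r).descFactorial r : ℝ) = (r + 2) * ((r + 1) * r.factorial) := by
    exact_mod_cast d2
  rw [i0, i1, i2, d0, d1] at hL
  simp only [nsmul_eq_mul] at hL
  push_cast at hL
  have hf : (0 : ℝ) < (r.factorial : ℝ) ^ 2 * (r + 1) := by positivity
  refine le_of_mul_le_mul_left ?_ hf
  calc _ = 2 * ((j : ℝ) + 2) * ((r.factorial) * elemSymm x s (j + 2) *
        ((2 + r).descFactorial r * elemSymm x s j)) := by
        linear_combination (-((j : ℝ) + 2) * (r.factorial) * elemSymm x s (j + 2) *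
          elemSymm x s j) * d2'
    _ ≤ _ := hL
    _ = _ := by ring

variable [DecidableEq ι]

theorem elemSymm_insert {s : Finset ι} {a : ι} (ha : a ∉ s) (k : ℕ) :
    elemSymm x (insert a s) (k + 1) = elemSymm x s (k + 1) + x a * elemSymm x s k := by
  have hinj : Set.InjOn (insert a) (s.powersetCard k : Set (Finset ι)) := by
    intro t ht t' ht' h
    have h1 : a ∉ t := fun h => ha ((Finset.mem_powersetCard.1 ht).1 h)
    have h2 : a ∉ t' := fun h => ha ((Finset.mem_powersetCard.1 ht').1 h)
    rw [← Finset.erase_insert h1, ← Finset.erase_insert h2, h]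
  rw [elemSymm, Finset.powersetCard_succ_insert ha, Finset.sum_union, Finset.sum_image hinj]
  · simp only [elemSymm, Finset.mul_sum]
    congr 1
    refine Finset.sum_congr rfl fun t ht => ?_
    rw [Finset.prod_insert fun h => ha ((Finset.mem_powersetCard.1 ht).1 h)]
  · rw [Finset.disjoint_left]
    intro t ht ht'
    obtain ⟨t', -, rfl⟩ := Finset.mem_image.1 ht'
    exact ha ((Finset.mem_powersetCard.1 ht).1 (Finset.mem_insert_self a t'))

theorem elemSymm_eq_erase {s : Finset ι} {a : ι} (ha : a ∈ s) (k : ℕ) :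
    elemSymm x s (k + 1) = elemSymm x (s.erase a) (k + 1) + x a * elemSymm x (s.erase a) k := by
  conv_lhs => rw [← Finset.insert_erase ha]
  exact elemSymm_insert x (Finset.notMem_erase a s) k

/-- Euler's identity for the elementary symmetric functions. -/
theorem sum_mul_elemSymm_erase (s : Finset ι) (k : ℕ) :
    ∑ i ∈ s, x i * elemSymm x (s.erase i) k = (k + 1) * elemSymm x s (k + 1) := by
  induction s using Finset.induction_on generalizing k with
  | empty => rw [elemSymm_eq_zero x (by simp)]; simp
  | insert a s ha ih =>
    rw [Finset.sum_insert ha, Finset.erase_insert ha, elemSymm_insert x ha]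
    have hne : ∀ i ∈ s, (insert a s).erase i = insert a (s.erase i) := fun i hi =>
      Finset.erase_insert_of_ne (by rintro rfl; exact ha hi)
    have hni : ∀ i ∈ s, a ∉ s.erase i := fun i _ h => ha (Finset.mem_of_mem_erase h)
    cases k with
    | zero =>
      simp only [elemSymm_zero, zero_add, elemSymm_one]
      simp [add_comm]
    | succ k =>
      have : ∀ i ∈ s, x i * elemSymm x ((insert a s).erase i) (k + 1) =
          x i * elemSymm x (s.erase i) (k + 1) + x a * (x i * elemSymm x (s.erase i) k) := by
        intro i hi
        rw [hne i hi, elemSymm_insert x (hni i hi)]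
        ring
      rw [Finset.sum_congr rfl this, Finset.sum_add_distrib, ← Finset.mul_sum, ih, ih]
      push_cast
      ring

/-- Replace `x_i S_k(x|i)` by `S_{k+1}(x) - S_{k+1}(x|i)` and apply Euler's identity. With `k`
lowered by one this evaluates `T = ∑ λ_i² F_i`. -/
theorem sum_sq_mul_elemSymm_erase (s : Finset ι) (k : ℕ) :
    ∑ i ∈ s, x i ^ 2 * elemSymm x (s.erase i) k =
      elemSymm x s 1 * elemSymm x s (k + 1) - (k + 2) * elemSymm x s (k + 2) := by
  have h := sum_mul_elemSymm_erase x s (k + 1)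
  have : ∀ i ∈ s, x i ^ 2 * elemSymm x (s.erase i) k =
      x i * elemSymm x s (k + 1) - x i * elemSymm x (s.erase i) (k + 1) := by
    intro i hi
    rw [elemSymm_eq_erase x hi k]
    ring
  rw [Finset.sum_congr rfl this, Finset.sum_sub_distrib, h, ← Finset.sum_mul, elemSymm_one]
  push_cast
  ring

end ElemSymm

/-! ### Inequalities in the Gårding cone -/

section GardingCone

variable {ι : Type*} [DecidableEq ι] {x : ι → ℝ} {s : Finset ι}

/-- Deleting one entry of a vector in the Gårding cone `Γ_k` leaves a vector in `Γ_{k-1}`. -/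
theorem elemSymm_erase_pos {k : ℕ} (hx : ∀ i, 1 ≤ i → i ≤ k → 0 < elemSymm x s i) {a : ι}
    (ha : a ∈ s) {j : ℕ} (hj : j < k) : 0 < elemSymm x (s.erase a) j := by
  induction j with
  | zero => rw [elemSymm_zero]; exact one_pos
  | succ j ih =>
    have hA := ih (by omega)
    -- Let `A, B, C` be `S_j, S_{j+1}, S_{j+2}` of `x|a`, and suppose `B ≤ 0`. Then `B + x_a A > 0`
    -- forces `x_a > 0`, and `C + x_a B > 0` gives `A C > B²`, against Newton's inequality, whose
    -- constant is below 1.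
    by_contra hB
    have h1 := hx (j + 1) (by omega) (by omega)
    have h2 := hx (j + 2) (by omega) (by omega)
    rw [elemSymm_eq_erase x ha] at h1 h2
    by_cases hc : (s.erase a).card < j + 2
    · rw [elemSymm_eq_zero x hc] at h2
      have hxa : 0 < x a := by
        by_contra hxa
        nlinarith
      nlinarith
    · obtain ⟨r, hr⟩ := Nat.exists_eq_add_of_le (not_lt.1 hc)
      have hN := newton_inequality x (s.erase a) j r hr
      set A := elemSymm x (s.erase a) j
      set B := elemSymm x (s.erase a) (j + 1)
      set C := elemSymm x (s.erase a) (j + 2)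
      have hB' : B ≤ 0 := not_lt.1 hB
      have hxa : 0 < x a := by
        by_contra hxa
        nlinarith
      have hlt : B ^ 2 < A * C := by nlinarith
      have hj0 : (0 : ℝ) ≤ j := j.cast_nonneg
      have hr0 : (0 : ℝ) ≤ r := r.cast_nonneg
      nlinarith [mul_pos (by positivity : (0 : ℝ) < (j + 2) * (r + 2)) (sub_pos.2 hlt),
        mul_nonneg (by positivity : (0 : ℝ) ≤ j + r + 3) (sq_nonneg B)]

/-- For `K ≥ 1` the difference of the two sides is `∑ x_i² S_{K-1}(x|i)`, whose terms are
nonnegative in `Γ_K`. -/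
theorem mul_elemSymm_succ_le {K : ℕ} (hx : ∀ i, 1 ≤ i → i ≤ K → 0 < elemSymm x s i) :
    ((K : ℝ) + 1) * elemSymm x s (K + 1) ≤ elemSymm x s 1 * elemSymm x s K := by
  cases K with
  | zero => simp [elemSymm_zero]
  | succ K =>
    have h := sum_sq_mul_elemSymm_erase x s K
    have h0 : 0 ≤ ∑ i ∈ s, x i ^ 2 * elemSymm x (s.erase i) K :=
      Finset.sum_nonneg fun i hi =>
        mul_nonneg (sq_nonneg _) (elemSymm_erase_pos hx hi (Nat.lt_succ_self K)).le
    push_cast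
    linarith

/-- For `x ∈ Γ_k` with a negative entry `x a`, the sum `∑ S_{k-1}(x|i) x_i²` controls
`n / (n - k)` times its `a`-th term; here `k = K + 1` and `n = K + 1 + d`. -/
theorem sum_sq_mul_elemSymm_erase_ge {K d : ℕ} (hcard : s.card = K + 1 + d) (hd : 1 ≤ d)
    (hx : ∀ i, 1 ≤ i → i ≤ K + 1 → 0 < elemSymm x s i) {a : ι} (ha : a ∈ s) (hneg : x a < 0) :
    ((K : ℝ) + 1 + d) * (x a ^ 2 * elemSymm x (s.erase a) K) ≤
      d * ∑ i ∈ s, x i ^ 2 * elemSymm x (s.erase i) K := by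
  have hcard' : (s.erase a).card = K + d := by rw [Finset.card_erase_of_mem ha]; omega
  have hA : 0 < elemSymm x (s.erase a) K := elemSymm_erase_pos hx ha (Nat.lt_succ_self K)
  have hW := mul_elemSymm_succ_le (x := x) (s := s.erase a) (K := K) fun i _ h =>
    elemSymm_erase_pos hx ha (by omega)
  have hN : ((K : ℝ) + 2) * d * (elemSymm x (s.erase a) K * elemSymm x (s.erase a) (K + 2)) ≤
      (K + 1) * (d - 1) * elemSymm x (s.erase a) (K + 1) ^ 2 := by
    -- Newton's inequality for the `K + d` remaining entries. For `d = 1` there are too few of them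
    -- and `S_{K+2}(x|a) = 0`.
    obtain rfl | ⟨r, rfl⟩ : d = 1 ∨ ∃ r, d = r + 2 := by
      rcases d with _ | _ | r
      · omega
      · exact Or.inl rfl
      · exact Or.inr ⟨r, rfl⟩
    · rw [elemSymm_eq_zero x (by rw [hcard']; omega : (s.erase a).card < K + 2)]
      simp
    · have := newton_inequality x (s.erase a) K r (by omega)
      push_cast
      linarith
  have hS := hx (K + 1) (by omega) le_rfl
  rw [sum_sq_mul_elemSymm_erase, elemSymm_eq_erase x ha (K + 1), elemSymm_eq_erase x ha K,
    elemSymm_eq_erase x ha 0, elemSymm_zero]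
  rw [elemSymm_eq_erase x ha K] at hS
  simp only [zero_add]
  set A := elemSymm x (s.erase a) K
  set B := elemSymm x (s.erase a) (K + 1)
  set C := elemSymm x (s.erase a) (K + 2)
  set D := elemSymm x (s.erase a) 1
  obtain ⟨y, hy, hxy⟩ : ∃ y : ℝ, 0 < y ∧ x a = -y := ⟨-x a, by linarith, by ring⟩
  rw [hxy] at hS ⊢
  have hyA : y * A ≤ B := by linarith
  have hyA0 : 0 ≤ y * A := by positivity
  have hd0 : (0 : ℝ) ≤ d := d.cast_nonneg
  have hK0 : (0 : ℝ) ≤ K := K.cast_nonneg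
  -- After multiplication by `A`, bound `D A` below by `(K+1) B` and `A C` above by Newton. The `y A
  -- B` terms cancel, leaving `(K+1) B² + d (yA)²`, and `B ≥ yA` finishes.
  refine le_of_mul_le_mul_left ?_ hA
  have e1 : 0 ≤ d * ((D * A - (K + 1) * B) * (B - y * A)) :=
    mul_nonneg hd0 (mul_nonneg (by linarith) (by linarith))
  have e2 : 0 ≤ ((K : ℝ) + 1) * (B ^ 2 - (y * A) ^ 2) :=
    mul_nonneg (by linarith) (by nlinarith)
  nlinarith

end GardingCone

/-! ### The algebra at the maximum point -/

/-- The nonnegativity of the quadratic expression left over after the maximum principle is applied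
to the gradient quotient. -/
theorem sum_quadratic_nonneg {ι : Type*} [Fintype ι] {F l y : ι → ℝ} {a d N t G : ℝ}
    (hF : ∀ i, 0 ≤ F i) (hd : 0 < d) (hN : 0 < N) (ha : a * d = N + d)
    (hT : ∀ i, l i < 0 → N * (l i ^ 2 * F i) ≤ d * ∑ j, l j ^ 2 * F j)
    (hy : ∀ i, 0 ≤ y i) (hG : G = ∑ i, y i) (hG0 : 0 < G) (ht : 0 < t) :
    G * ∑ i, F i * ((a ^ 2 - a) * y i / t ^ 2) ≤
      ∑ i, F i * ((a * G / t + l i) ^ 2 * y i / G + l i ^ 2) := by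
  set T := ∑ j, l j ^ 2 * F j with hTdef
  have hT0 : 0 ≤ T := Finset.sum_nonneg fun j _ => mul_nonneg (sq_nonneg _) (hF j)
  have ha1 : 0 < a - 1 := by
    have : (a - 1) * d = N := by linarith
    by_contra h
    nlinarith
  set s := G / t
  have hs : 0 < s := div_pos hG0 ht
  -- For `l i < 0` complete the square: the bracket is `a (s + l i)² - (a - 1) (l i)²`, and `T`
  -- absorbs the negative part.
  have key : ∀ i, 0 ≤ T + F i * (a * s ^ 2 + 2 * a * l i * s + l i ^ 2) := by
    intro i
    rcases le_or_gt 0 (l i) with h | h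
    · have := hF i
      have : 0 ≤ a := by linarith
      positivity
    · have h1 : (a - 1) * (l i ^ 2 * F i) ≤ T := by
        refine le_of_mul_le_mul_left ?_ hd
        calc d * ((a - 1) * (l i ^ 2 * F i)) = N * (l i ^ 2 * F i) := by
              linear_combination (l i ^ 2 * F i) * ha
          _ ≤ _ := hT i h
      have h2 : 0 ≤ F i * (a * (s + l i) ^ 2) :=
        mul_nonneg (hF i) (mul_nonneg (by linarith) (sq_nonneg _))
      nlinarith
  have hsum : 0 ≤ ∑ i, y i * (T + F i * (a * s ^ 2 + 2 * a * l i * s + l i ^ 2)) :=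
    Finset.sum_nonneg fun i _ => mul_nonneg (hy i) (key i)
  -- Since `G = ∑ y i`, the single sum `T` can be distributed over the indices with weights `y i`.
  have hyT : ∑ i, y i * T = ∑ i, G * (l i ^ 2 * F i) := by
    rw [← Finset.sum_mul, ← hG, ← Finset.mul_sum]
  have hdiff : G * (∑ i, F i * ((a * G / t + l i) ^ 2 * y i / G + l i ^ 2) -
      G * ∑ i, F i * ((a ^ 2 - a) * y i / t ^ 2)) =
      ∑ i, y i * (T + F i * (a * s ^ 2 + 2 * a * l i * s + l i ^ 2)) := by
    simp only [mul_add (y _) T, Finset.sum_add_distrib]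
    rw [hyT, ← Finset.sum_add_distrib, Finset.mul_sum, ← Finset.sum_sub_distrib, Finset.mul_sum]
    refine Finset.sum_congr rfl fun i _ => ?_
    have hsG : s = G / t := rfl
    rw [hsG]
    field_simp
    ring
  rw [← hdiff] at hsum
  have := nonneg_of_mul_nonneg_right hsum hG0
  linarith

/-- The algebraic part of the interior gradient estimate, at a point where the complex Hessian is
diagonal with entries `l i`. Here `z i` and `W j i` are the complex first and second derivatives,
`t` is minus the value of the function and `X i` collects the third-order terms. -/
theorem gradient_bound_of_critical {ι : Type*} [Fintype ι] {F l X : ι → ℝ} {z : ι → ℂ}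
    {W : ι → ι → ℂ} {a d N t G E H : ℝ}
    (hF : ∀ i, 0 ≤ F i) (hd : 0 < d) (hN : 0 < N) (ha : a * d = N + d)
    (hT : ∀ i, l i < 0 → N * (l i ^ 2 * F i) ≤ d * ∑ j, l j ^ 2 * F j)
    (hG : G = ∑ i, ‖z i‖ ^ 2) (hG0 : 0 < G) (ht : 0 < t)
    (hcrit : ∀ i, ∑ j, W j i * (starRingEnd ℂ) (z j) + l i * z i = -(a * G / t : ℝ) * z i)
    (hsecond : ∀ i, X i + (∑ j, ‖W j i‖ ^ 2 + l i ^ 2) ≤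
      G * ((a ^ 2 - a) * ‖z i‖ ^ 2 / t ^ 2 - a * l i / t))
    (hX : -(2 * (√G * √H)) ≤ ∑ i, F i * X i) (hE : ∑ i, F i * l i = E) :
    a * E / t * √G ≤ 2 * √H := by
  -- The critical equation says that `∑_j W j i * conj (z j)` equals `-(aG/t + l i) z i`; apply
  -- Cauchy–Schwarz.
  have hCS : ∀ i, (a * G / t + l i) ^ 2 * ‖z i‖ ^ 2 / G ≤ ∑ j, ‖W j i‖ ^ 2 := by
    intro i
    have h1 : ‖∑ j, W j i * (starRingEnd ℂ) (z j)‖ = |a * G / t + l i| * ‖z i‖ := by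
      have : ∑ j, W j i * (starRingEnd ℂ) (z j) = -((a * G / t + l i : ℝ) : ℂ) * z i := by
        push_cast
        have := hcrit i
        push_cast at this
        linear_combination this
      rw [this, norm_mul, norm_neg, Complex.norm_real, Real.norm_eq_abs]
    have h2 : ‖∑ j, W j i * (starRingEnd ℂ) (z j)‖ ≤ ∑ j, ‖W j i‖ * ‖z j‖ := by
      refine (norm_sum_le _ _).trans_eq ?_
      simp
    have h3 : (∑ j, ‖W j i‖ * ‖z j‖) ^ 2 ≤ (∑ j, ‖W j i‖ ^ 2) * ∑ j, ‖z j‖ ^ 2 :=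
      Finset.sum_mul_sq_le_sq_mul_sq _ _ _
    rw [div_le_iff₀ hG0, hG]
    refine le_trans ?_ h3
    rw [← sq_abs (a * (∑ i, ‖z i‖ ^ 2) / t + l i), ← mul_pow, ← hG, ← h1]
    exact pow_le_pow_left₀ (norm_nonneg _) h2 2
  have hmain := sum_quadratic_nonneg hF hd hN ha hT (fun i => sq_nonneg ‖z i‖) hG hG0 ht
  have h4 : ∑ i, F i * ((a * G / t + l i) ^ 2 * ‖z i‖ ^ 2 / G + l i ^ 2) + ∑ i, F i * X i ≤
      G * ∑ i, F i * ((a ^ 2 - a) * ‖z i‖ ^ 2 / t ^ 2) - G * (a * E / t) := by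
    rw [← hE, ← Finset.sum_add_distrib, Finset.mul_sum, Finset.mul_sum, Finset.sum_div,
      Finset.mul_sum, ← Finset.sum_sub_distrib]
    refine Finset.sum_le_sum fun i _ => ?_
    have h5 := mul_le_mul_of_nonneg_left (hsecond i) (hF i)
    have h6 := mul_le_mul_of_nonneg_left (hCS i) (hF i)
    calc _ ≤ F i * (X i + (∑ j, ‖W j i‖ ^ 2 + l i ^ 2)) := by linarith
      _ ≤ _ := h5
      _ = _ := by ring
  have hs : 0 < √G := Real.sqrt_pos.2 hG0
  have h7 : G * (a * E / t) ≤ 2 * (√G * √H) := by linarith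
  refine le_of_mul_le_mul_left ?_ hs
  calc √G * (a * E / t * √G) = (√G * √G) * (a * E / t) := by ring
    _ = G * (a * E / t) := by rw [Real.mul_self_sqrt hG0.le]
    _ ≤ _ := h7
    _ = _ := by ring

/-! ### Principal minors and the first variation of `S_k` -/

section Minors

variable {ι : Type*} [Fintype ι] [DecidableEq ι]

/-- The elementary symmetric functions of the eigenvalues of a Hermitian matrix are the sums of its
principal minors. -/
theorem esymm_roots_charpoly_eq_sum_minors {A : Matrix ι ι ℂ} (hA : A.IsHermitian) {k : ℕ}
    (hk : k ≤ Fintype.card ι) :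
    (((A.charpoly.roots.map Complex.re).esymm k : ℝ) : ℂ) =
      ∑ s ∈ Finset.univ.powersetCard k,
        (A.submatrix (Subtype.val : s → ι) (Subtype.val : s → ι)).det := by
  have h1 := A.charpoly_coeff_eq_sum_minors k hk
  have h2 := Polynomial.coeff_eq_esymm_roots_of_splits hA.splits_charpoly
    (k := Fintype.card ι - k) (by rw [A.charpoly_natDegree_eq_dim]; omega)
  rw [A.charpoly_natDegree_eq_dim, Nat.sub_sub_self hk, A.charpoly_monic.leadingCoeff, one_mul,
    h1] at h2
  rw [mul_left_cancel₀ (pow_ne_zero k (by norm_num)) h2, hA.roots_charpoly_eq_eigenvalues,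
    Multiset.map_map]
  have e1 : (Finset.univ.val.map (Complex.re ∘ RCLike.ofReal ∘ hA.eigenvalues)) =
      Finset.univ.val.map hA.eigenvalues := by
    congr 1
  rw [e1, Finset.esymm_map_val, Finset.esymm_map_val]
  push_cast
  rfl

theorem esymm_roots_charpoly_diagonal (l : ι → ℝ) (k : ℕ) :
    ((Matrix.diagonal fun i => (l i : ℂ)).charpoly.roots.map Complex.re).esymm k =
      elemSymm l Finset.univ k := by
  have h : (Matrix.diagonal fun i => (l i : ℂ)).charpoly.roots =
      Finset.univ.val.map fun i => (l i : ℂ) := by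
    rw [Matrix.charpoly_diagonal, ← Polynomial.roots_multiset_prod_X_sub_C
      (Finset.univ.val.map fun i => (l i : ℂ)), Multiset.map_map]
    rfl
  rw [h, Multiset.map_map]
  exact Finset.esymm_map_val _ _ _

/-- Jacobi's formula at a diagonal matrix. -/
theorem hasDerivAt_det_of_diagonal {A : ℝ → Matrix ι ι ℂ} {A' : Matrix ι ι ℂ} {l : ι → ℂ}
    (h0 : A 0 = Matrix.diagonal l) (hA : ∀ i j, HasDerivAt (fun t => A t i j) (A' i j) 0) :
    HasDerivAt (fun t => (A t).det) (∑ i, A' i i * ∏ j ∈ Finset.univ.erase i, l j) 0 := by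
  have h1 : ∀ σ : Equiv.Perm ι, HasDerivAt
      (fun t => (Equiv.Perm.sign σ : ℤ) • ∏ i, A t (σ i) i)
      ((Equiv.Perm.sign σ : ℤ) • ∑ i, (∏ j ∈ Finset.univ.erase i, A 0 (σ j) j) • A' (σ i) i) 0 :=
    fun σ => (HasDerivAt.fun_finsetProd fun i _ => hA (σ i) i).const_smul _
  have h2 := HasDerivAt.fun_sum (u := Finset.univ) fun σ _ => h1 σ
  simp only [Matrix.det_apply, Units.smul_def]
  refine h2.congr_deriv ?_
  -- A permutation other than the identity moves at least two indices, so an off-diagonal zero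
  -- survives after one factor is differentiated.
  rw [Finset.sum_eq_single (1 : Equiv.Perm ι)]
  · simp [h0, mul_comm]
  · intro σ _ hσ
    refine smul_eq_zero_of_right _ (Finset.sum_eq_zero fun i _ => ?_)
    obtain ⟨j, hji, hj⟩ : ∃ j, j ≠ i ∧ σ j ≠ j := by
      by_contra! h
      refine hσ (Equiv.ext fun j => ?_)
      by_cases hji : j = i
      · subst hji
        by_contra hne
        exact hne (σ.injective (h _ hne))
      · exact h j hji
    rw [Finset.prod_eq_zero (Finset.mem_erase.2 ⟨hji, Finset.mem_univ j⟩), zero_smul]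
    rw [h0, Matrix.diagonal_apply_ne _ hj]
  · simp

/-- The derivative of the sum of the principal minors of order `K + 1` at a diagonal matrix. -/
theorem hasDerivAt_sum_minors_of_diagonal {A : ℝ → Matrix ι ι ℂ} {A' : Matrix ι ι ℂ} {l : ι → ℝ}
    (h0 : A 0 = Matrix.diagonal fun i => (l i : ℂ))
    (hA : ∀ i j, HasDerivAt (fun t => A t i j) (A' i j) 0) (K : ℕ) :
    HasDerivAt (fun t => ∑ s ∈ Finset.univ.powersetCard (K + 1),
        ((A t).submatrix (Subtype.val : s → ι) (Subtype.val : s → ι)).det)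
      (∑ i, A' i i * (elemSymm l (Finset.univ.erase i) K : ℝ)) 0 := by
  have h1 : ∀ s : Finset ι, HasDerivAt
      (fun t => ((A t).submatrix (Subtype.val : s → ι) (Subtype.val : s → ι)).det)
      (∑ i ∈ s, A' i i * ∏ j ∈ s.erase i, (l j : ℂ)) 0 := by
    intro s
    have := hasDerivAt_det_of_diagonal (ι := s)
      (A := fun t => (A t).submatrix (Subtype.val : s → ι) (Subtype.val : s → ι))
      (A' := A'.submatrix Subtype.val Subtype.val) (l := fun i => (l i : ℂ))
      (by rw [h0]; ext i j; by_cases h : i = j <;> simp [h])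
      (fun i j => hA i j)
    refine this.congr_deriv ?_
    rw [← Finset.sum_coe_sort s]
    refine Finset.sum_congr rfl fun i _ => ?_
    simp only [Matrix.submatrix_apply]
    congr 1
    refine Finset.prod_bij' (fun j _ => (j : ι))
      (fun j hj => ⟨j, Finset.mem_of_mem_erase hj⟩) ?_ ?_ ?_ ?_ ?_
    · intro j hj
      exact Finset.mem_erase.2 ⟨fun h => (Finset.mem_erase.1 hj).1 (Subtype.ext h), j.2⟩
    · intro j hj
      exact Finset.mem_erase.2
        ⟨fun h => (Finset.mem_erase.1 hj).1 (congrArg Subtype.val h), Finset.mem_univ _⟩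
    · intro j _
      rfl
    · intro j _
      rfl
    · intro j _
      rfl
  refine (HasDerivAt.fun_sum fun s _ => h1 s).congr_deriv ?_
  have h2 : ∀ i, A' i i * ((elemSymm l (Finset.univ.erase i) K : ℝ) : ℂ) =
      ∑ t ∈ (Finset.univ.erase i).powersetCard K, A' i i * ∏ j ∈ t, (l j : ℂ) := by
    intro i
    rw [elemSymm]
    push_cast
    rw [Finset.mul_sum]
  simp only [h2]
  rw [Finset.sum_sigma', Finset.sum_sigma']
  -- Pairs `(s, i)` with `i ∈ s` correspond to pairs `(i, t)` with `i ∉ t`, through `t = s.erase i`.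
  refine Finset.sum_bij' (fun p _ => ⟨p.2, p.1.erase p.2⟩) (fun p _ => ⟨insert p.1 p.2, p.1⟩)
    ?_ ?_ ?_ ?_ ?_
  · rintro ⟨s, i⟩ h
    simp only [Finset.mem_sigma, Finset.mem_powersetCard, Finset.mem_univ, true_and] at h ⊢
    exact ⟨Finset.erase_subset_erase _ (Finset.subset_univ _), by
      rw [Finset.card_erase_of_mem h.2]; omega⟩
  · rintro ⟨i, t⟩ h
    simp only [Finset.mem_sigma, Finset.mem_powersetCard, Finset.mem_univ, true_and] at h ⊢
    have hi : i ∉ t := fun hi => Finset.notMem_erase i _ (h.1 hi)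
    exact ⟨⟨Finset.subset_univ _, by rw [Finset.card_insert_of_notMem hi, h.2]⟩,
      Finset.mem_insert_self _ _⟩
  · rintro ⟨s, i⟩ h
    simp only [Finset.mem_sigma] at h
    simp [Finset.insert_erase h.2]
  · rintro ⟨i, t⟩ h
    simp only [Finset.mem_sigma, Finset.mem_powersetCard, Finset.mem_univ, true_and] at h
    have hi : i ∉ t := fun hi => Finset.notMem_erase i _ (h.1 hi)
    simp [Finset.erase_insert hi]
  · rintro ⟨s, i⟩ h
    rfl

end Minors

/-! ### Real directional derivatives and second-order conditions -/

section DirectionalDerivative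

open Filter Topology

variable {E : Type*} [NormedAddCommGroup E] [NormedSpace ℝ E]

/-- The derivative of `v` in the direction `a`. -/
def dirDeriv (a : E) (v : E → ℝ) (w : E) : ℝ := fderiv ℝ v w a

/-- `v` is smooth at all points near `w`. -/
def SmoothNear (v : E → ℝ) (w : E) : Prop := ∀ᶠ w' in 𝓝 w, ContDiffAt ℝ ∞ v w'

namespace SmoothNear

variable {v : E → ℝ} {w : E}

theorem contDiffAt (h : SmoothNear v w) : ContDiffAt ℝ ∞ v w := h.self_of_nhds

theorem differentiableAt (h : SmoothNear v w) : DifferentiableAt ℝ v w :=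
  h.contDiffAt.differentiableAt (by simp)

theorem eventually (h : SmoothNear v w) : ∀ᶠ w' in 𝓝 w, SmoothNear v w' :=
  eventually_eventually_nhds.2 h

theorem along (h : SmoothNear v w) (a : E) : SmoothNear (dirDeriv a v) w := by
  filter_upwards [h] with w' hw'
  exact (hw'.fderiv_right (m := ∞) (by simp)).clm_apply contDiffAt_const

theorem comp_continuousLinearEquiv {F : Type*} [NormedAddCommGroup F] [NormedSpace ℝ F]
    (T : F ≃L[ℝ] E) {w : F} (h : SmoothNear v (T w)) : SmoothNear (v ∘ T) w := by
  filter_upwards [T.continuous.continuousAt.eventually h] with w' hw'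
  exact hw'.comp w' T.contDiff.contDiffAt

end SmoothNear

variable {v g : E → ℝ} {w : E}

theorem dirDeriv_congr (h : v =ᶠ[𝓝 w] g) (a : E) : dirDeriv a v =ᶠ[𝓝 w] dirDeriv a g := by
  filter_upwards [h.eventuallyEq_nhds] with w' hw'
  rw [dirDeriv, dirDeriv, hw'.fderiv_eq]

theorem dirDeriv_comm_apply (h : SmoothNear v w) (a b : E) :
    dirDeriv a (dirDeriv b v) w = dirDeriv b (dirDeriv a v) w := by
  have hd : DifferentiableAt ℝ (fderiv ℝ v) w :=
    (h.contDiffAt.fderiv_right (m := 1) (by norm_cast)).differentiableAt (by simp)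
  have hs : IsSymmSndFDerivAt ℝ v w := h.contDiffAt.isSymmSndFDerivAt
    (by simpa using WithTop.coe_le_coe.2 (le_top : (2 : ℕ∞) ≤ ⊤))
  have key : ∀ a b : E, dirDeriv a (dirDeriv b v) w = fderiv ℝ (fderiv ℝ v) w a b := by
    intro a b
    have := hd.hasFDerivAt.clm_apply (hasFDerivAt_const b w)
    change fderiv ℝ (fun w' => fderiv ℝ v w' b) w a = _
    rw [this.fderiv]
    simp
  rw [key, key, hs.eq]

theorem dirDeriv_comm (h : SmoothNear v w) (a b : E) :
    dirDeriv a (dirDeriv b v) =ᶠ[𝓝 w] dirDeriv b (dirDeriv a v) := by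
  filter_upwards [h.eventually] with w' hw'
  exact dirDeriv_comm_apply hw' a b

/-- Matches the order of differentiation in the differentiated equation with that in the
second-order conditions. -/
theorem dirDeriv_comm_third (h : SmoothNear v w) (a b : E) :
    dirDeriv b (dirDeriv a (dirDeriv a v)) w = dirDeriv a (dirDeriv a (dirDeriv b v)) w := by
  rw [dirDeriv_comm_apply (h.along a), (dirDeriv_congr (dirDeriv_comm h b a) a).self_of_nhds]

theorem hasDerivAt_line (a : E) {t : ℝ} (h : DifferentiableAt ℝ v (w + t • a)) :
    HasDerivAt (fun s : ℝ => v (w + s • a)) (dirDeriv a v (w + t • a)) t := by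
  have hl : HasDerivAt (fun s : ℝ => w + s • a) a t := by
    simpa using ((hasDerivAt_id t).smul_const a).const_add w
  exact h.hasFDerivAt.comp_hasDerivAt t hl

theorem hasDerivAt_line_zero (a : E) (h : DifferentiableAt ℝ v w) :
    HasDerivAt (fun s : ℝ => v (w + s • a)) (dirDeriv a v w) 0 := by
  have := hasDerivAt_line (v := v) (w := w) a (t := 0) (by simpa using h)
  simpa using this

theorem tendsto_line (a : E) : Tendsto (fun s : ℝ => w + s • a) (𝓝 0) (𝓝 w) := by
  have : Continuous fun s : ℝ => w + s • a := by fun_prop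
  simpa using this.tendsto 0

theorem SmoothNear.eventually_hasDerivAt_line (h : SmoothNear v w) (a : E) :
    ∀ᶠ t : ℝ in 𝓝 0, HasDerivAt (fun s : ℝ => v (w + s • a)) (dirDeriv a v (w + t • a)) t := by
  filter_upwards [(tendsto_line a).eventually h.eventually] with t ht
  exact hasDerivAt_line a ht.differentiableAt

/-- The necessary conditions of second order at a local maximum of a function of one variable. -/
theorem isLocalMax_second_order {φ φ' : ℝ → ℝ} {c : ℝ} (hmax : IsLocalMax φ 0)
    (h1 : ∀ᶠ t in 𝓝 0, HasDerivAt φ (φ' t) t) (h2 : HasDerivAt φ' c 0) : φ' 0 = 0 ∧ c ≤ 0 := by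
  have h0 : φ' 0 = 0 := hmax.hasDerivAt_eq_zero h1.self_of_nhds
  refine ⟨h0, ?_⟩
  by_contra! hc
  have hd : deriv φ =ᶠ[𝓝 0] φ' := h1.mono fun t ht => ht.deriv
  have hdd : deriv (deriv φ) 0 = c := by rw [hd.deriv_eq, h2.deriv]
  -- A positive second derivative would make 0 a local minimum as well, so `φ` would be locally
  -- constant.
  have hmin : IsLocalMin φ 0 := isLocalMin_of_deriv_deriv_pos (by rw [hdd]; exact hc)
    (by rw [hd.self_of_nhds, h0]) h1.self_of_nhds.continuousAt
  have hconst : φ =ᶠ[𝓝 0] fun _ => φ 0 := by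
    filter_upwards [hmax, hmin] with t ht ht'
    exact le_antisymm ht ht'
  have : deriv (deriv φ) 0 = 0 := by
    rw [hconst.deriv.deriv_eq]
    simp
  linarith

theorem dirDeriv_dirDeriv_nonpos_of_isLocalMax (hmax : IsLocalMax v w) (h : SmoothNear v w) (a : E) :
    dirDeriv a (dirDeriv a v) w ≤ 0 := by
  have hm : IsLocalMax (fun t : ℝ => v (w + t • a)) 0 := by
    have := (tendsto_line (w := w) a).eventually hmax
    simpa [IsLocalMax, IsMaxFilter] using this
  exact (isLocalMax_second_order hm (h.eventually_hasDerivAt_line a)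
    (hasDerivAt_line_zero a (h.along a).differentiableAt)).2

end DirectionalDerivative

/-! ### Wirtinger derivatives and the complex Hessian in real coordinates -/

section Wirtinger

open Filter Topology

variable {n : ℕ} {v g : EuclideanSpace ℂ (Fin n) → ℝ} {w : EuclideanSpace ℂ (Fin n)}

/-- The unit vector of the `i`-th real coordinate. -/
abbrev unitRe (i : Fin n) : EuclideanSpace ℂ (Fin n) := EuclideanSpace.single i 1

/-- The unit vector of the `i`-th imaginary coordinate. -/
abbrev unitIm (i : Fin n) : EuclideanSpace ℂ (Fin n) := EuclideanSpace.single i Complex.I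

theorem fderiv_ofReal_apply (h : DifferentiableAt ℝ v w) (a : EuclideanSpace ℂ (Fin n)) :
    fderiv ℝ (fun w => (v w : ℂ)) w a = (dirDeriv a v w : ℂ) := by
  have : HasFDerivAt (fun w => (v w : ℂ)) (Complex.ofRealCLM.comp (fderiv ℝ v w)) w :=
    Complex.ofRealCLM.hasFDerivAt.comp w h.hasFDerivAt
  rw [this.fderiv]
  rfl

theorem dz_ofReal (h : DifferentiableAt ℝ v w) (i : Fin n) :
    dz i (fun w => (v w : ℂ)) w =
      (dirDeriv (unitRe i) v w - Complex.I * dirDeriv (unitIm i) v w) / 2 := by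
  rw [dz, fderiv_ofReal_apply h, fderiv_ofReal_apply h]

theorem dzbar_ofReal (h : DifferentiableAt ℝ v w) (i : Fin n) :
    dzbar i (fun w => (v w : ℂ)) w =
      (dirDeriv (unitRe i) v w + Complex.I * dirDeriv (unitIm i) v w) / 2 := by
  rw [dzbar, fderiv_ofReal_apply h, fderiv_ofReal_apply h]

theorem norm_dz_ofReal_sq (h : DifferentiableAt ℝ v w) (i : Fin n) :
    ‖dz i (fun w => (v w : ℂ)) w‖ ^ 2 =
      (dirDeriv (unitRe i) v w ^ 2 + dirDeriv (unitIm i) v w ^ 2) / 4 := by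
  rw [dz_ofReal h, Complex.sq_norm, Complex.normSq_apply]
  simp
  ring

theorem gradSq_eq (h : DifferentiableAt ℝ v w) :
    gradSq v w =
      (∑ i, (dirDeriv (unitRe i) v w ^ 2 + dirDeriv (unitIm i) v w ^ 2)) / 4 := by
  rw [gradSq, Finset.sum_div]
  exact Finset.sum_congr rfl fun i _ => norm_dz_ofReal_sq h i

theorem gradSq_nonneg : 0 ≤ gradSq v w :=
  Finset.sum_nonneg fun _ _ => sq_nonneg _

theorem hasFDerivAt_dzbar_ofReal (h : SmoothNear v w) (j : Fin n) :
    HasFDerivAt (dzbar j fun w => (v w : ℂ))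
      ((2⁻¹ : ℂ) • (Complex.ofRealCLM.comp (fderiv ℝ (dirDeriv (unitRe j) v) w) +
        Complex.I • Complex.ofRealCLM.comp (fderiv ℝ (dirDeriv (unitIm j) v) w))) w := by
  have he : (dzbar j fun w => (v w : ℂ)) =ᶠ[𝓝 w] fun w => (2⁻¹ : ℂ) •
      ((dirDeriv (unitRe j) v w : ℂ) + Complex.I • (dirDeriv (unitIm j) v w : ℂ)) := by
    filter_upwards [h.eventually] with w' hw'
    rw [dzbar_ofReal hw'.differentiableAt, smul_eq_mul, smul_eq_mul]
    ring
  have h1 : ∀ a : EuclideanSpace ℂ (Fin n), HasFDerivAt (fun w => (dirDeriv a v w : ℂ))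
      (Complex.ofRealCLM.comp (fderiv ℝ (dirDeriv a v) w)) w := fun a =>
    Complex.ofRealCLM.hasFDerivAt.comp w (h.along a).differentiableAt.hasFDerivAt
  exact (((h1 _).add ((h1 _).const_smul Complex.I)).const_smul (2⁻¹ : ℂ)).congr_of_eventuallyEq he

theorem complexHessian_apply (h : SmoothNear v w) (i j : Fin n) :
    complexHessian v w i j =
      ((dirDeriv (unitRe i) (dirDeriv (unitRe j) v) w +
          dirDeriv (unitIm i) (dirDeriv (unitIm j) v) w : ℝ) +
        Complex.I * (dirDeriv (unitRe i) (dirDeriv (unitIm j) v) w -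
          dirDeriv (unitIm i) (dirDeriv (unitRe j) v) w : ℝ)) / 4 := by
  rw [complexHessian, Matrix.of_apply, dz, (hasFDerivAt_dzbar_ofReal h j).fderiv]
  simp only [smul_apply, add_apply,
    ContinuousLinearMap.comp_apply, Complex.ofRealCLM_apply, smul_eq_mul]
  push_cast
  simp only [← dirDeriv.eq_def (E := EuclideanSpace ℂ (Fin n))]
  linear_combination (-(1 / 4 : ℂ) * (dirDeriv (unitIm i) (dirDeriv (unitIm j) v) w : ℂ)) * Complex.I_mul_I

theorem isHermitian_complexHessian (h : SmoothNear v w) : (complexHessian v w).IsHermitian := by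
  ext i j
  rw [Matrix.conjTranspose_apply, complexHessian_apply h, complexHessian_apply h,
    dirDeriv_comm_apply h (unitRe j), dirDeriv_comm_apply h (unitRe j),
    dirDeriv_comm_apply h (unitIm j), dirDeriv_comm_apply h (unitIm j)]
  simp only [Complex.star_def, map_div₀, map_add, map_mul, Complex.conj_ofReal, Complex.conj_I,
    map_ofNat]
  push_cast
  ring

end Wirtinger

/-! ### The gradient estimate where the Hessian is diagonal -/

section

open Filter Topology

variable {n : ℕ} {v g : EuclideanSpace ℂ (Fin n) → ℝ} {w : EuclideanSpace ℂ (Fin n)}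

/-- The first variation of the `k`-Hessian equation, `k = K + 1`, at a point where the complex
Hessian is diagonal. -/
theorem sum_elemSymm_mul_dirDeriv_eq {K : ℕ} (hK : K + 1 ≤ n) (hv : SmoothNear v w)
    (hg : DifferentiableAt ℝ g w) (heq : hessianOp (K + 1) v =ᶠ[𝓝 w] g) {l : Fin n → ℝ}
    (hdiag : complexHessian v w = Matrix.diagonal fun i => (l i : ℂ))
    (a : EuclideanSpace ℂ (Fin n)) :
    ∑ i, elemSymm l (Finset.univ.erase i) K *
      ((dirDeriv a (dirDeriv (unitRe i) (dirDeriv (unitRe i) v)) w +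
        dirDeriv a (dirDeriv (unitIm i) (dirDeriv (unitIm i) v)) w) / 4) = dirDeriv a g w := by
  -- The entrywise derivative of the Hessian along `a`. The sum of principal minors, unlike the
  -- individual eigenvalues, is visibly differentiable in the entries.
  set A' : Matrix (Fin n) (Fin n) ℂ := Matrix.of fun i j =>
    ((dirDeriv a (dirDeriv (unitRe i) (dirDeriv (unitRe j) v)) w +
          dirDeriv a (dirDeriv (unitIm i) (dirDeriv (unitIm j) v)) w : ℝ) +
        Complex.I * (dirDeriv a (dirDeriv (unitRe i) (dirDeriv (unitIm j) v)) w -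
          dirDeriv a (dirDeriv (unitIm i) (dirDeriv (unitRe j) v)) w : ℝ)) / 4
  have hnear : ∀ᶠ t : ℝ in 𝓝 0, SmoothNear v (w + t • a) := (tendsto_line a).eventually hv.eventually
  have hline : ∀ b c : EuclideanSpace ℂ (Fin n),
      HasDerivAt (fun t : ℝ => dirDeriv b (dirDeriv c v) (w + t • a))
        (dirDeriv a (dirDeriv b (dirDeriv c v)) w) 0 := fun b c =>
    hasDerivAt_line_zero a ((hv.along c).along b).differentiableAt
  have hA : ∀ i j, HasDerivAt (fun t : ℝ => complexHessian v (w + t • a) i j) (A' i j) 0 := by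
    intro i j
    have h1 := ((((hline (unitRe i) (unitRe j)).add (hline (unitIm i) (unitIm j))).ofReal_comp).add
      ((((hline (unitRe i) (unitIm j)).sub (hline (unitIm i) (unitRe j))).ofReal_comp).const_mul
        Complex.I)).div_const 4
    refine h1.congr_of_eventuallyEq ?_
    filter_upwards [hnear] with t ht
    rw [complexHessian_apply ht]
    rfl
  have h2 := hasDerivAt_sum_minors_of_diagonal (A := fun t : ℝ => complexHessian v (w + t • a))
    (by simpa using hdiag) hA K
  have h3 : HasDerivAt (fun t : ℝ => (g (w + t • a) : ℂ)) (dirDeriv a g w : ℂ) 0 :=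
    (hasDerivAt_line_zero a hg).ofReal_comp
  have h4 : (fun t : ℝ => (g (w + t • a) : ℂ)) =ᶠ[𝓝 0]
      fun t : ℝ => ∑ s ∈ Finset.univ.powersetCard (K + 1), ((complexHessian v (w + t • a)).submatrix
        (Subtype.val : s → Fin n) (Subtype.val : s → Fin n)).det := by
    filter_upwards [hnear, (tendsto_line a).eventually heq] with t ht ht'
    rw [← ht', ← esymm_roots_charpoly_eq_sum_minors (isHermitian_complexHessian ht)
      (by simpa using hK)]
    rfl
  have h5 := congrArg Complex.re ((h2.congr_of_eventuallyEq h4).unique h3)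
  rw [Complex.ofReal_re, Complex.re_sum] at h5
  rw [← h5]
  refine Finset.sum_congr rfl fun i _ => ?_
  rw [Complex.re_mul_ofReal, mul_comm]
  congr 1
  simp [A', -Complex.ofReal_add, -Complex.ofReal_sub]

/-- The conditions of first and second order in the direction `a` at a local maximum of
`|Dv|² (-v)^(-p)`. -/
theorem conditions_of_isLocalMax_gradSq_mul_rpow (hv : SmoothNear v w) {p : ℝ} (hneg : v w < 0)
    (hmax : IsLocalMax (fun z => gradSq v z * (-v z) ^ (-p)) w) (a : EuclideanSpace ℂ (Fin n)) :
    (∑ i, (dirDeriv (unitRe i) v w * dirDeriv a (dirDeriv (unitRe i) v) w +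
        dirDeriv (unitIm i) v w * dirDeriv a (dirDeriv (unitIm i) v) w)) / 2 =
      -(p * gradSq v w / (-v w)) * dirDeriv a v w ∧
    (∑ i, (dirDeriv a (dirDeriv (unitRe i) v) w ^ 2 +
        dirDeriv (unitRe i) v w * dirDeriv a (dirDeriv a (dirDeriv (unitRe i) v)) w +
        (dirDeriv a (dirDeriv (unitIm i) v) w ^ 2 +
        dirDeriv (unitIm i) v w * dirDeriv a (dirDeriv a (dirDeriv (unitIm i) v)) w))) / 2 ≤
      gradSq v w * ((p ^ 2 - p) * dirDeriv a v w ^ 2 / (-v w) ^ 2 -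
        p * dirDeriv a (dirDeriv a v) w / (-v w)) := by
  have ht0 : 0 < -v w := by linarith
  set M := gradSq v w * (-v w) ^ (-p) with hM
  have hMG : ∀ q : ℝ, M * (-v w) ^ (p - q) = gradSq v w * (-v w) ^ (-q) := by
    intro q
    rw [hM, mul_assoc, ← Real.rpow_add ht0]
    congr 2
    ring
  have hG : M * (-v w) ^ p = gradSq v w := by simpa using hMG 0
  have hG1 : M * (-v w) ^ (p - 1) = gradSq v w / (-v w) := by
    rw [hMG, Real.rpow_neg_one, div_eq_mul_inv]
  have hG2 : M * (-v w) ^ (p - 2) = gradSq v w / (-v w) ^ 2 := by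
    rw [hMG, Real.rpow_neg ht0.le, Real.rpow_two, div_eq_mul_inv]
  have hline := tendsto_line (w := w) a
  have hnear := hline.eventually hv.eventually
  have hnegn : ∀ᶠ t : ℝ in 𝓝 0, v (w + t • a) < 0 :=
    hline.eventually (hv.contDiffAt.continuousAt.eventually_lt continuousAt_const hneg)
  -- With `M` the maximal value, `|Dv|² - M (-v)^p` has a local maximum 0 at the same point, and is
  -- easier to differentiate than the quotient.
  set φ : ℝ → ℝ := fun t => (∑ i, (dirDeriv (unitRe i) v (w + t • a) ^ 2 +
    dirDeriv (unitIm i) v (w + t • a) ^ 2)) / 4 - M * (-v (w + t • a)) ^ p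
  set φ' : ℝ → ℝ := fun t =>
    (∑ i, (dirDeriv (unitRe i) v (w + t • a) * dirDeriv a (dirDeriv (unitRe i) v) (w + t • a) +
      dirDeriv (unitIm i) v (w + t • a) * dirDeriv a (dirDeriv (unitIm i) v) (w + t • a))) / 2 +
      M * (dirDeriv a v (w + t • a) * p * (-v (w + t • a)) ^ (p - 1))
  have hφmax : IsLocalMax φ 0 := by
    filter_upwards [hnear, hnegn, hline.eventually hmax] with t ht htn htm
    have e1 : φ 0 = 0 := by
      have := gradSq_eq hv.differentiableAt
      simp only [φ, zero_smul, add_zero, ← this, hG, sub_self]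
    have htn' : 0 < -v (w + t • a) := by linarith
    rw [e1]
    simp only [φ, ← gradSq_eq ht.differentiableAt]
    rw [sub_nonpos]
    calc gradSq v (w + t • a)
        = gradSq v (w + t • a) * (-v (w + t • a)) ^ (-p) * (-v (w + t • a)) ^ p := by
          rw [mul_assoc, ← Real.rpow_add htn']
          simp
      _ ≤ _ := mul_le_mul_of_nonneg_right htm (Real.rpow_nonneg htn'.le p)
  have h1 : ∀ᶠ t in 𝓝 0, HasDerivAt φ (φ' t) t := by
    filter_upwards [hnear, hnegn] with t ht htn
    have hd : ∀ b, HasDerivAt (fun s : ℝ => dirDeriv b v (w + s • a) ^ 2)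
        (2 * dirDeriv b v (w + t • a) * dirDeriv a (dirDeriv b v) (w + t • a)) t := fun b => by
      simpa using (hasDerivAt_line a (ht.along b).differentiableAt).fun_pow 2
    have hpow : HasDerivAt (fun s : ℝ => (-v (w + s • a)) ^ p)
        (-dirDeriv a v (w + t • a) * p * (-v (w + t • a)) ^ (p - 1)) t :=
      (hasDerivAt_line a ht.differentiableAt).neg.rpow_const (Or.inl (by simpa using htn.ne))
    refine (((HasDerivAt.fun_sum fun i _ => (hd (unitRe i)).add (hd (unitIm i))).div_const 4).sub
      (hpow.const_mul M)).congr_deriv ?_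
    simp only [φ', Finset.sum_div, sub_eq_add_neg]
    congr 1
    · exact Finset.sum_congr rfl fun i _ => by ring
    · ring
  have h2 : HasDerivAt φ' ((∑ i, (dirDeriv a (dirDeriv (unitRe i) v) w ^ 2 +
        dirDeriv (unitRe i) v w * dirDeriv a (dirDeriv a (dirDeriv (unitRe i) v)) w +
        (dirDeriv a (dirDeriv (unitIm i) v) w ^ 2 +
        dirDeriv (unitIm i) v w * dirDeriv a (dirDeriv a (dirDeriv (unitIm i) v)) w))) / 2 +
      M * (dirDeriv a (dirDeriv a v) w * p * (-v w) ^ (p - 1) -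
        dirDeriv a v w * p * (dirDeriv a v w * (p - 1) * (-v w) ^ (p - 2)))) 0 := by
    have hd : ∀ b, HasDerivAt
        (fun s : ℝ => dirDeriv b v (w + s • a) * dirDeriv a (dirDeriv b v) (w + s • a))
        (dirDeriv a (dirDeriv b v) w ^ 2 +
          dirDeriv b v w * dirDeriv a (dirDeriv a (dirDeriv b v)) w) 0 := fun b => by
      refine ((hasDerivAt_line_zero a (hv.along b).differentiableAt).mul
        (hasDerivAt_line_zero a ((hv.along b).along a).differentiableAt)).congr_deriv ?_
      simp
      ring
    have hpow : HasDerivAt (fun s : ℝ => (-v (w + s • a)) ^ (p - 1))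
        (-dirDeriv a v w * (p - 1) * (-v w) ^ (p - 2)) 0 := by
      refine ((hasDerivAt_line_zero a hv.differentiableAt).neg.rpow_const
        (Or.inl (by simpa using hneg.ne))).congr_deriv ?_
      simp only [zero_smul, add_zero, Pi.neg_apply]
      congr 2
      ring
    have ha := (hasDerivAt_line_zero a (hv.along a).differentiableAt).mul_const p
    refine (((HasDerivAt.fun_sum fun i _ => (hd (unitRe i)).add (hd (unitIm i))).div_const 2).add
      ((ha.mul hpow).const_mul M)).congr_deriv ?_
    simp only [zero_smul, add_zero]
    ring
  obtain ⟨e1, e2⟩ := isLocalMax_second_order hφmax h1 h2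
  constructor
  · simp only [φ', zero_smul, add_zero] at e1
    linear_combination e1 - p * dirDeriv a v w * hG1
  · have e3 : M * (dirDeriv a (dirDeriv a v) w * p * (-v w) ^ (p - 1) -
        dirDeriv a v w * p * (dirDeriv a v w * (p - 1) * (-v w) ^ (p - 2))) =
        -(gradSq v w * ((p ^ 2 - p) * dirDeriv a v w ^ 2 / (-v w) ^ 2 -
        p * dirDeriv a (dirDeriv a v) w / (-v w))) := by
      linear_combination (p * dirDeriv a (dirDeriv a v) w) * hG1 -
        (dirDeriv a v w ^ 2 * p * (p - 1)) * hG2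
    linarith

theorem neg_sqrt_mul_sqrt_le_sum {ι : Type*} [Fintype ι] (a b c d : ι → ℝ) :
    -(√(∑ i, (a i ^ 2 + b i ^ 2)) * √(∑ i, (c i ^ 2 + d i ^ 2))) ≤
      ∑ i, (a i * c i + b i * d i) := by
  have h := Real.sum_sqrt_mul_sqrt_le Finset.univ (f := fun i => a i ^ 2 + b i ^ 2)
    (g := fun i => c i ^ 2 + d i ^ 2) (fun i => by positivity) (fun i => by positivity)
  refine (neg_le_neg h).trans ?_
  rw [← Finset.sum_neg_distrib]
  refine Finset.sum_le_sum fun i _ => ?_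
  rw [neg_le, ← Real.sqrt_mul (by positivity)]
  apply Real.le_sqrt_of_sq_le
  nlinarith [sq_nonneg (a i * d i - b i * c i)]

/-- The interior gradient estimate at a local maximum of the gradient quotient where the complex
Hessian is diagonal. -/
theorem gradient_bound_of_isLocalMax_of_diagonal {k : ℕ} (hk : 1 ≤ k) (hkn : k < n)
    (hv : SmoothNear v w) (hg : DifferentiableAt ℝ g w) (heq : hessianOp k v =ᶠ[𝓝 w] g)
    {l : Fin n → ℝ} (hdiag : complexHessian v w = Matrix.diagonal fun i => (l i : ℂ))
    (hcone : ∀ i, 1 ≤ i → i ≤ k → 0 < elemSymm l Finset.univ i) (hneg : v w < 0)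
    (hmax : IsLocalMax (gradQuotient k v) w) (hG : 0 < gradSq v w) :
    (2 * (n : ℝ) - k) / ((n : ℝ) - k) * (k * g w) / (-v w) * √(gradSq v w) ≤
      2 * √(gradSq g w) := by
  obtain ⟨K, rfl⟩ := Nat.exists_eq_add_of_le' hk
  obtain ⟨d, hnd⟩ := Nat.exists_eq_add_of_le hkn.le
  have hd1 : 1 ≤ d := by omega
  have hd0 : (0 : ℝ) < d := by exact_mod_cast hd1
  have hndR : (n : ℝ) = K + 1 + d := by exact_mod_cast hnd
  set p : ℝ := (2 * (n : ℝ) - (K + 1 : ℕ)) / ((n : ℝ) - (K + 1 : ℕ)) with hp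
  have hpd : p * d = n + d := by
    have : (n : ℝ) - (K + 1 : ℕ) = d := by push_cast; linarith
    rw [hp, this, div_mul_cancel₀ _ hd0.ne']
    push_cast
    linarith
  have hcond := conditions_of_isLocalMax_gradSq_mul_rpow (p := p) hv hneg hmax
  have ht : 0 < -v w := by linarith
  set G := gradSq v w
  set t := -v w
  have hdv := hv.differentiableAt
  have hl : ∀ i, l i = (dirDeriv (unitRe i) (dirDeriv (unitRe i) v) w +
      dirDeriv (unitIm i) (dirDeriv (unitIm i) v) w) / 4 := by
    intro i
    have h1 := congrArg Complex.re (congrFun (congrFun hdiag i) i)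
    rw [complexHessian_apply hv, Matrix.diagonal_apply_eq, Complex.ofReal_re] at h1
    rw [← h1]
    simp [-Complex.ofReal_add, -Complex.ofReal_sub]
  set F : Fin n → ℝ := fun i => elemSymm l (Finset.univ.erase i) K
  -- `X i` is `2 Re ∑_j conj(v_j) v_{i ī j}`, and `W j i` below is the (2,0) derivative `v_{ij}`.
  set X : Fin n → ℝ := fun i => (∑ j,
    (dirDeriv (unitRe j) v w *
      ((dirDeriv (unitRe i) (dirDeriv (unitRe i) (dirDeriv (unitRe j) v)) w +
        dirDeriv (unitIm i) (dirDeriv (unitIm i) (dirDeriv (unitRe j) v)) w) / 4) +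
    dirDeriv (unitIm j) v w *
      ((dirDeriv (unitRe i) (dirDeriv (unitRe i) (dirDeriv (unitIm j) v)) w +
        dirDeriv (unitIm i) (dirDeriv (unitIm i) (dirDeriv (unitIm j) v)) w) / 4))) / 2
  set W : Fin n → Fin n → ℂ := fun j i =>
    ((dirDeriv (unitRe i) (dirDeriv (unitRe j) v) w -
        dirDeriv (unitIm i) (dirDeriv (unitIm j) v) w : ℝ) -
      Complex.I * (dirDeriv (unitRe i) (dirDeriv (unitIm j) v) w +
        dirDeriv (unitIm i) (dirDeriv (unitRe j) v) w : ℝ)) / 4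
  have hsumF : ∀ a, ∑ i, F i *
      ((dirDeriv (unitRe i) (dirDeriv (unitRe i) (dirDeriv a v)) w +
        dirDeriv (unitIm i) (dirDeriv (unitIm i) (dirDeriv a v)) w) / 4) = dirDeriv a g w := by
    intro a
    rw [← sum_elemSymm_mul_dirDeriv_eq hkn.le hv hg heq hdiag a]
    refine Finset.sum_congr rfl fun i _ => ?_
    rw [dirDeriv_comm_third hv, dirDeriv_comm_third hv]
  refine gradient_bound_of_critical (F := F) (l := l) (X := X) (W := W)
    (z := fun i => dz i (fun w => (v w : ℂ)) w) (a := p) (d := d) (N := n) (t := t) (G := G)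
    (fun i => (elemSymm_erase_pos hcone (Finset.mem_univ i) (Nat.lt_succ_self K)).le) hd0
    (by rw [hndR]; positivity) hpd ?_ rfl hG ht ?_ ?_ ?_ ?_
  · intro i hi
    have := sum_sq_mul_elemSymm_erase_ge (s := Finset.univ) (by simpa using hnd) hd1 hcone
      (Finset.mem_univ i) hi
    rwa [← hndR] at this
  -- The complex critical equation is half of the `x_i` condition minus `√-1` times the `y_i`
  -- condition.
  · intro i
    have hx := (hcond (unitRe i)).1
    have hy := (hcond (unitIm i)).1
    have h1 : (l i : ℂ) * dz i (fun w => (v w : ℂ)) w =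
        ∑ j, complexHessian v w i j * dz j (fun w => (v w : ℂ)) w := by
      rw [hdiag, Finset.sum_eq_single i]
      · rw [Matrix.diagonal_apply_eq]
      · intro j _ hj
        rw [Matrix.diagonal_apply_ne _ hj.symm, zero_mul]
      · simp
    rw [h1, ← Finset.sum_add_distrib]
    have h2 : ∀ j, W j i * (starRingEnd ℂ) (dz j (fun w => (v w : ℂ)) w) +
        complexHessian v w i j * dz j (fun w => (v w : ℂ)) w =
        (((dirDeriv (unitRe j) v w * dirDeriv (unitRe i) (dirDeriv (unitRe j) v) w +
          dirDeriv (unitIm j) v w * dirDeriv (unitRe i) (dirDeriv (unitIm j) v) w : ℝ) : ℂ) -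
        Complex.I * (dirDeriv (unitRe j) v w * dirDeriv (unitIm i) (dirDeriv (unitRe j) v) w +
          dirDeriv (unitIm j) v w * dirDeriv (unitIm i) (dirDeriv (unitIm j) v) w : ℝ)) / 4 := by
      intro j
      rw [dz_ofReal hdv, complexHessian_apply hv]
      simp only [W, map_div₀, map_sub, map_mul, Complex.conj_ofReal, Complex.conj_I, map_ofNat]
      push_cast
      linear_combination (-(1 / 4 : ℂ) *
        (dirDeriv (unitRe i) (dirDeriv (unitIm j) v) w * dirDeriv (unitIm j) v w)) *
          Complex.I_sq
    rw [Finset.sum_congr rfl fun j _ => h2 j, ← Finset.sum_div, Finset.sum_sub_distrib,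
      ← Finset.mul_sum, ← Complex.ofReal_sum, ← Complex.ofReal_sum, dz_ofReal hdv]
    have hx' := congrArg (Complex.ofReal) hx
    have hy' := congrArg (Complex.ofReal) hy
    push_cast at hx' hy' ⊢
    linear_combination (hx' - Complex.I * hy') / 2
  -- Since `∂_i ∂̄_i` is a quarter of the real Laplacian in `(x_i, y_i)`, add the two real
  -- conditions and divide by 4.
  · intro i
    have hx := (hcond (unitRe i)).2
    have hy := (hcond (unitIm i)).2
    have h1 : l i ^ 2 = ∑ j, ‖complexHessian v w i j‖ ^ 2 := by
      rw [hdiag, Finset.sum_eq_single i]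
      · rw [Matrix.diagonal_apply_eq, Complex.norm_real, Real.norm_eq_abs, sq_abs]
      · intro j _ hj
        rw [Matrix.diagonal_apply_ne _ hj.symm]
        simp
      · simp
    have h2 : ∀ j, ‖W j i‖ ^ 2 + ‖complexHessian v w i j‖ ^ 2 =
        (dirDeriv (unitRe i) (dirDeriv (unitRe j) v) w ^ 2 +
          dirDeriv (unitRe i) (dirDeriv (unitIm j) v) w ^ 2 +
          (dirDeriv (unitIm i) (dirDeriv (unitRe j) v) w ^ 2 +
          dirDeriv (unitIm i) (dirDeriv (unitIm j) v) w ^ 2)) / 8 := by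
      have hform : ∀ x y : ℝ, ‖((x : ℂ) + Complex.I * y) / 4‖ ^ 2 = (x ^ 2 + y ^ 2) / 16 := by
        intro x y
        rw [Complex.sq_norm, Complex.normSq_apply]
        simp
        ring
      intro j
      have hW : W j i = (((dirDeriv (unitRe i) (dirDeriv (unitRe j) v) w -
          dirDeriv (unitIm i) (dirDeriv (unitIm j) v) w : ℝ) : ℂ) +
          Complex.I * (-(dirDeriv (unitRe i) (dirDeriv (unitIm j) v) w +
          dirDeriv (unitIm i) (dirDeriv (unitRe j) v) w) : ℝ)) / 4 := by
        simp only [W]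
        push_cast
        ring
      rw [hW, complexHessian_apply hv, hform, hform]
      ring
    rw [h1, ← Finset.sum_add_distrib, Finset.sum_congr rfl fun j _ => h2 j, norm_dz_ofReal_sq hdv,
      hl i]
    have h3 : X i + ∑ j, (dirDeriv (unitRe i) (dirDeriv (unitRe j) v) w ^ 2 +
          dirDeriv (unitRe i) (dirDeriv (unitIm j) v) w ^ 2 +
          (dirDeriv (unitIm i) (dirDeriv (unitRe j) v) w ^ 2 +
          dirDeriv (unitIm i) (dirDeriv (unitIm j) v) w ^ 2)) / 8 =
        ((∑ j, (dirDeriv (unitRe i) (dirDeriv (unitRe j) v) w ^ 2 +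
        dirDeriv (unitRe j) v w * dirDeriv (unitRe i) (dirDeriv (unitRe i) (dirDeriv (unitRe j) v)) w +
        (dirDeriv (unitRe i) (dirDeriv (unitIm j) v) w ^ 2 +
        dirDeriv (unitIm j) v w *
          dirDeriv (unitRe i) (dirDeriv (unitRe i) (dirDeriv (unitIm j) v)) w))) / 2 +
        (∑ j, (dirDeriv (unitIm i) (dirDeriv (unitRe j) v) w ^ 2 +
        dirDeriv (unitRe j) v w * dirDeriv (unitIm i) (dirDeriv (unitIm i) (dirDeriv (unitRe j) v)) w +
        (dirDeriv (unitIm i) (dirDeriv (unitIm j) v) w ^ 2 +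
        dirDeriv (unitIm j) v w *
          dirDeriv (unitIm i) (dirDeriv (unitIm i) (dirDeriv (unitIm j) v)) w))) / 2) / 4 := by
      simp only [X, Finset.sum_div, ← Finset.sum_add_distrib]
      exact Finset.sum_congr rfl fun j _ => by ring
    rw [h3]
    refine (div_le_div_of_nonneg_right (add_le_add hx hy) (by norm_num)).trans_eq ?_
    ring
  -- The differentiated equation turns the third-order terms into a pairing of `Dv` with `Dg`;
  -- Cauchy–Schwarz bounds it.
  · have h1 : ∑ i, F i * X i = (∑ j, (dirDeriv (unitRe j) v w * dirDeriv (unitRe j) g w +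
        dirDeriv (unitIm j) v w * dirDeriv (unitIm j) g w)) / 2 := by
      simp only [← hsumF, X, Finset.sum_div, Finset.mul_sum]
      rw [Finset.sum_comm]
      refine Finset.sum_congr rfl fun j _ => ?_
      rw [← Finset.sum_add_distrib, Finset.sum_div]
      exact Finset.sum_congr rfl fun i _ => by ring
    have h2 := neg_sqrt_mul_sqrt_le_sum (fun j => dirDeriv (unitRe j) v w)
      (fun j => dirDeriv (unitIm j) v w) (fun j => dirDeriv (unitRe j) g w)
      (fun j => dirDeriv (unitIm j) g w)
    have h3 : √(4 : ℝ) = 2 := by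
      rw [show (4 : ℝ) = 2 ^ 2 by norm_num, Real.sqrt_sq (by norm_num)]
    have h4 : ∀ h : EuclideanSpace ℂ (Fin n) → ℝ, DifferentiableAt ℝ h w →
        √(∑ j, (dirDeriv (unitRe j) h w ^ 2 + dirDeriv (unitIm j) h w ^ 2)) =
        2 * √(gradSq h w) := by
      intro h hh
      have : ∑ j, (dirDeriv (unitRe j) h w ^ 2 + dirDeriv (unitIm j) h w ^ 2) =
          4 * gradSq h w := by
        rw [gradSq_eq hh]
        ring
      rw [this, Real.sqrt_mul (by norm_num), h3]
    rw [h4 v hdv, h4 g hg] at h2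
    rw [h1]
    change -(2 * (√(gradSq v w) * √(gradSq g w))) ≤ _
    linarith
  · have h1 : g w = elemSymm l Finset.univ (K + 1) := by
      rw [← heq.self_of_nhds, hessianOp, hessianEigenvalues, hdiag, esymm_roots_charpoly_diagonal]
    rw [h1]
    push_cast
    rw [← sum_mul_elemSymm_erase]
    exact Finset.sum_congr rfl fun i _ => mul_comm _ _

end

/-! ### Unitary invariance and reduction to a diagonal Hessian -/

section

open Filter Topology

section UnitaryChange

variable {n : ℕ}

/-- The real-linear equivalence of `ℂⁿ` taking the standard basis to `b`. -/
def basisChange (b : OrthonormalBasis (Fin n) ℂ (EuclideanSpace ℂ (Fin n))) :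
    EuclideanSpace ℂ (Fin n) ≃L[ℝ] EuclideanSpace ℂ (Fin n) :=
  b.repr.symm.toContinuousLinearEquiv.restrictScalars ℝ

variable (b : OrthonormalBasis (Fin n) ℂ (EuclideanSpace ℂ (Fin n)))

theorem basisChange_unitRe (i : Fin n) : basisChange b (unitRe i) = b i :=
  b.repr_symm_single i

theorem basisChange_unitIm (i : Fin n) : basisChange b (unitIm i) = Complex.I • b i := by
  have : unitIm i = Complex.I • unitRe i := by
    ext j
    by_cases hj : j = i <;> simp [unitIm, unitRe, hj]
  rw [this]
  change b.repr.symm _ = _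
  rw [map_smul]
  exact congrArg _ (b.repr_symm_single i)

theorem clm_apply_eq_sum (f : EuclideanSpace ℂ (Fin n) →L[ℝ] ℂ) (c : EuclideanSpace ℂ (Fin n)) :
    f c = ∑ i, ((c i).re * f (unitRe i) + (c i).im * f (unitIm i)) := by
  have h1 : c = ∑ i, ((c i).re • unitRe i + (c i).im • unitIm i) := by
    ext j
    rw [WithLp.ofLp_sum, Finset.sum_apply, Finset.sum_eq_single j]
    · simp [unitRe, unitIm, Complex.re_add_im]
    · intro i _ hi
      simp [unitRe, unitIm, hi.symm]
    · simp
  conv_lhs => rw [h1, map_sum]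
  refine Finset.sum_congr rfl fun i _ => ?_
  rw [map_add, map_smul, map_smul, Complex.real_smul, Complex.real_smul]

theorem dz_comp_basisChange (g : EuclideanSpace ℂ (Fin n) → ℂ) (i : Fin n)
    (w : EuclideanSpace ℂ (Fin n)) :
    dz i (fun w => g (basisChange b w)) w = ∑ j, b i j * dz j g (basisChange b w) := by
  have h := (basisChange b).comp_right_fderiv (f := g) (x := w)
  change (fderiv ℝ (g ∘ basisChange b) w _ - _ * fderiv ℝ (g ∘ basisChange b) w _) / 2 = _
  rw [h]
  change (fderiv ℝ g (basisChange b w) (basisChange b (unitRe i)) -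
    _ * fderiv ℝ g (basisChange b w) (basisChange b (unitIm i))) / 2 = _
  rw [basisChange_unitRe, basisChange_unitIm, clm_apply_eq_sum _ (b i),
    clm_apply_eq_sum _ (Complex.I • b i), Finset.mul_sum, ← Finset.sum_sub_distrib, Finset.sum_div]
  refine Finset.sum_congr rfl fun j _ => ?_
  rw [dz]
  conv_rhs => rw [← Complex.re_add_im (b i j)]
  simp only [PiLp.smul_apply, smul_eq_mul, Complex.I_mul_re, Complex.I_mul_im]
  push_cast
  linear_combination (((b i j).im : ℂ) * fderiv ℝ g (basisChange b w) (unitIm j) / 2) * Complex.I_sq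

theorem dzbar_comp_basisChange (g : EuclideanSpace ℂ (Fin n) → ℂ) (i : Fin n)
    (w : EuclideanSpace ℂ (Fin n)) :
    dzbar i (fun w => g (basisChange b w)) w =
      ∑ j, star (b i j) * dzbar j g (basisChange b w) := by
  have h := (basisChange b).comp_right_fderiv (f := g) (x := w)
  change (fderiv ℝ (g ∘ basisChange b) w _ + _ * fderiv ℝ (g ∘ basisChange b) w _) / 2 = _
  rw [h]
  change (fderiv ℝ g (basisChange b w) (basisChange b (unitRe i)) +
    _ * fderiv ℝ g (basisChange b w) (basisChange b (unitIm i))) / 2 = _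
  rw [basisChange_unitRe, basisChange_unitIm, clm_apply_eq_sum _ (b i),
    clm_apply_eq_sum _ (Complex.I • b i), Finset.mul_sum, ← Finset.sum_add_distrib, Finset.sum_div]
  refine Finset.sum_congr rfl fun j _ => ?_
  rw [dzbar]
  conv_rhs => rw [← Complex.re_add_im (b i j)]
  simp only [PiLp.smul_apply, smul_eq_mul, Complex.I_mul_re, Complex.I_mul_im, Complex.star_def,
    map_add, map_mul, Complex.conj_ofReal, Complex.conj_I]
  push_cast
  linear_combination (((b i j).im : ℂ) * fderiv ℝ g (basisChange b w) (unitIm j) / 2) * Complex.I_sq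

theorem gradSq_comp_basisChange (u : EuclideanSpace ℂ (Fin n) → ℝ)
    (w : EuclideanSpace ℂ (Fin n)) :
    gradSq (u ∘ basisChange b) w = gradSq u (basisChange b w) := by
  -- The conjugate makes the new Wirtinger derivatives the inner products `⟪G, b i⟫`, so Parseval
  -- applies.
  set G : EuclideanSpace ℂ (Fin n) :=
    WithLp.toLp 2 fun j => star (dz j (fun z => (u z : ℂ)) (basisChange b w))
  have h1 : ∀ i, dz i (fun z => ((u ∘ basisChange b) z : ℂ)) w = inner ℂ G (b i) := by
    intro i
    have := dz_comp_basisChange b (fun z => (u z : ℂ)) i w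
    refine this.trans ?_
    rw [PiLp.inner_apply]
    refine Finset.sum_congr rfl fun j _ => ?_
    simp [G]
  rw [gradSq, gradSq, Finset.sum_congr rfl fun i _ => by rw [h1 i], b.sum_sq_norm_inner_left,
    EuclideanSpace.norm_sq_eq]
  simp [G]

/-- The matrix of a change of orthonormal basis, with the basis vectors as rows. -/
def basisMatrix : Matrix (Fin n) (Fin n) ℂ := Matrix.of fun i j => b i j

theorem basisMatrix_mul_conjTranspose : basisMatrix b * (basisMatrix b).conjTranspose = 1 := by
  ext i j
  have h := orthonormal_iff_ite.1 b.orthonormal j i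
  rw [PiLp.inner_apply] at h
  rw [Matrix.mul_apply, Matrix.one_apply]
  simp only [eq_comm (a := i) (b := j)]
  rw [← h]
  exact Finset.sum_congr rfl fun l _ => by simp [basisMatrix]

theorem complexHessian_comp_basisChange {u : EuclideanSpace ℂ (Fin n) → ℝ}
    {w : EuclideanSpace ℂ (Fin n)} (hu : SmoothNear u (basisChange b w)) :
    complexHessian (u ∘ basisChange b) w =
      basisMatrix b * complexHessian u (basisChange b w) * (basisMatrix b).conjTranspose := by
  ext i j
  have h1 : (dzbar j fun z => ((u ∘ basisChange b) z : ℂ)) =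
      fun z => (fun z' => ∑ l, star (b j l) * dzbar l (fun z => (u z : ℂ)) z') (basisChange b z) :=
    funext fun z => dzbar_comp_basisChange b (fun z => (u z : ℂ)) j z
  have h2 : ∀ m, dz m (fun z' => ∑ l, star (b j l) * dzbar l (fun z => (u z : ℂ)) z')
      (basisChange b w) = ∑ l, star (b j l) * complexHessian u (basisChange b w) m l := by
    intro m
    have h3 : ∀ l, DifferentiableAt ℝ (dzbar l fun z => (u z : ℂ)) (basisChange b w) := fun l =>
      (hasFDerivAt_dzbar_ofReal hu l).differentiableAt
    have h4 := HasFDerivAt.fun_sum (u := Finset.univ) fun l _ =>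
      ((h3 l).hasFDerivAt.const_mul (star (b j l)))
    rw [dz, h4.fderiv, sum_apply, sum_apply, Finset.mul_sum,
      ← Finset.sum_sub_distrib, Finset.sum_div]
    refine Finset.sum_congr rfl fun l _ => ?_
    simp only [smul_apply, smul_eq_mul, complexHessian, Matrix.of_apply, dz]
    ring
  have h3 := dz_comp_basisChange b
    (fun z' => ∑ l, star (b j l) * dzbar l (fun z => (u z : ℂ)) z') i w
  rw [← h1] at h3
  refine h3.trans ?_
  rw [Matrix.mul_assoc, Matrix.mul_apply]
  refine Finset.sum_congr rfl fun m _ => ?_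
  rw [h2, Matrix.mul_apply]
  congr 1
  refine Finset.sum_congr rfl fun l _ => ?_
  rw [mul_comm]
  rfl

theorem hessianOp_comp_basisChange {u : EuclideanSpace ℂ (Fin n) → ℝ}
    {w : EuclideanSpace ℂ (Fin n)} (hu : SmoothNear u (basisChange b w)) (k : ℕ) :
    hessianOp k (u ∘ basisChange b) w = hessianOp k u (basisChange b w) := by
  have h : (complexHessian (u ∘ basisChange b) w).charpoly =
      (complexHessian u (basisChange b w)).charpoly := by
    rw [complexHessian_comp_basisChange b hu, Matrix.mul_assoc, Matrix.charpoly_mul_comm,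
      Matrix.mul_assoc, mul_eq_one_comm.1 (basisMatrix_mul_conjTranspose b), Matrix.mul_one]
  rw [hessianOp, hessianOp, hessianEigenvalues, hessianEigenvalues, h]

/-- The complex Hessian is diagonal in a suitable orthonormal basis. -/
theorem exists_basisChange_diagonal {u : EuclideanSpace ℂ (Fin n) → ℝ}
    {z : EuclideanSpace ℂ (Fin n)} (hu : SmoothNear u z) :
    ∃ (b : OrthonormalBasis (Fin n) ℂ (EuclideanSpace ℂ (Fin n))) (l : Fin n → ℝ),
      complexHessian (u ∘ basisChange b) ((basisChange b).symm z) =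
        Matrix.diagonal fun i => (l i : ℂ) := by
  -- The Hessian `H` transforms as `B H Bᴴ` with the `b i` as rows of `B`. The rows must be left
  -- eigenvectors of `H`, hence the transpose.
  have hH : (complexHessian u z).transpose.IsHermitian := (isHermitian_complexHessian hu).transpose
  refine ⟨hH.eigenvectorBasis, hH.eigenvalues, ?_⟩
  set b := hH.eigenvectorBasis
  have hz : basisChange b ((basisChange b).symm z) = z := (basisChange b).apply_symm_apply z
  rw [complexHessian_comp_basisChange b (by rwa [hz]), hz]
  have h1 : basisMatrix b * complexHessian u z =
      Matrix.diagonal (fun i => (hH.eigenvalues i : ℂ)) * basisMatrix b := by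
    ext i j
    rw [Matrix.diagonal_mul]
    have := congrFun (hH.mulVec_eigenvectorBasis i) j
    rw [Matrix.mulVec_transpose] at this
    simpa [basisMatrix, Matrix.mul_apply, Matrix.vecMul, dotProduct] using this
  rw [h1, Matrix.mul_assoc, basisMatrix_mul_conjTranspose, Matrix.mul_one]

/-- The interior gradient estimate at a local maximum of the gradient quotient. -/
theorem gradient_bound_of_isLocalMax {u f : EuclideanSpace ℂ (Fin n) → ℝ}
    {z : EuclideanSpace ℂ (Fin n)} {k : ℕ} (hk : 1 ≤ k) (hkn : k < n) (hu : SmoothNear u z)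
    (hf : DifferentiableAt ℝ f z) (heq : hessianOp k u =ᶠ[𝓝 z] f)
    (hcone : ∀ i, 1 ≤ i → i ≤ k → 0 < hessianOp i u z) (hneg : u z < 0)
    (hmax : IsLocalMax (gradQuotient k u) z) (hG : 0 < gradSq u z) :
    (2 * (n : ℝ) - k) / ((n : ℝ) - k) * (k * f z) / (-u z) * √(gradSq u z) ≤
      2 * √(gradSq f z) := by
  obtain ⟨b, l, hdiag⟩ := exists_basisChange_diagonal hu
  set w := (basisChange b).symm z
  have hw : basisChange b w = z := (basisChange b).apply_symm_apply z
  rw [← hw] at hu hf heq hneg hmax hG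
  have hT : Tendsto (basisChange b) (𝓝 w) (𝓝 (basisChange b w)) :=
    (basisChange b).continuous.tendsto w
  have hquot : gradQuotient k (u ∘ basisChange b) = gradQuotient k u ∘ basisChange b := by
    funext y
    simp only [gradQuotient, gradSq_comp_basisChange, Function.comp]
  have hop : ∀ i, hessianOp i (u ∘ basisChange b) w = elemSymm l Finset.univ i := by
    intro i
    rw [hessianOp, hessianEigenvalues, hdiag, esymm_roots_charpoly_diagonal]
  have key := gradient_bound_of_isLocalMax_of_diagonal (v := u ∘ basisChange b)
    (g := f ∘ basisChange b) hk hkn (hu.comp_continuousLinearEquiv _)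
    (hf.comp w (basisChange b).differentiableAt) ?_ hdiag ?_ hneg ?_ ?_
  · rw [gradSq_comp_basisChange, gradSq_comp_basisChange] at key
    simpa only [Function.comp, hw] using key
  · filter_upwards [hT.eventually hu.eventually, hT.eventually heq] with y hy hy'
    rw [hessianOp_comp_basisChange b hy, hy']
    rfl
  · intro i hi hik
    rw [← hop, hessianOp_comp_basisChange b hu, hw]
    exact hcone i hi hik
  · rw [hquot]
    exact hT.eventually hmax
  · rwa [gradSq_comp_basisChange]

end UnitaryChange

end

/-! ### Continuity, the sign of `u`, and the ring domain -/

section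

open Filter Topology

variable {n k : ℕ}

theorem continuousAt_gradSq {u : EuclideanSpace ℂ (Fin n) → ℝ} {z : EuclideanSpace ℂ (Fin n)}
    (hu : SmoothNear u z) : ContinuousAt (gradSq u) z := by
  have h : gradSq u =ᶠ[𝓝 z] fun w =>
      (∑ i, (dirDeriv (unitRe i) u w ^ 2 + dirDeriv (unitIm i) u w ^ 2)) / 4 := by
    filter_upwards [hu.eventually] with w hw
    exact gradSq_eq hw.differentiableAt
  refine ContinuousAt.congr ?_ h.symm
  have h1 : ∀ a, ContinuousAt (dirDeriv a u) z := fun a => (hu.along a).contDiffAt.continuousAt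
  refine ContinuousAt.div_const ?_ 4
  exact tendsto_finsetSum _ fun i _ => ((h1 _).pow 2).add ((h1 _).pow 2)

theorem continuousAt_gradQuotient {u : EuclideanSpace ℂ (Fin n) → ℝ}
    {z : EuclideanSpace ℂ (Fin n)} (hu : SmoothNear u z) (hneg : u z < 0) :
    ContinuousAt (gradQuotient k u) z :=
  (continuousAt_gradSq hu).mul
    (hu.contDiffAt.continuousAt.neg.rpow_const (Or.inl (by simpa using hneg.ne)))

theorem gradQuotient_nonneg {u : EuclideanSpace ℂ (Fin n) → ℝ} {z : EuclideanSpace ℂ (Fin n)}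
    (hneg : u z ≤ 0) : 0 ≤ gradQuotient k u z :=
  mul_nonneg gradSq_nonneg (Real.rpow_nonneg (by linarith) _)

theorem gradSq_log {f : EuclideanSpace ℂ (Fin n) → ℝ} {z : EuclideanSpace ℂ (Fin n)}
    (hf : DifferentiableAt ℝ f z) (h0 : f z ≠ 0) :
    gradSq f z = f z ^ 2 * gradSq (fun w => Real.log (f w)) z := by
  have hlog := hf.hasFDerivAt.log h0
  have h : ∀ a, dirDeriv a f z = f z * dirDeriv a (fun w => Real.log (f w)) z := by
    intro a
    rw [dirDeriv, dirDeriv, hlog.fderiv]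
    simp [mul_inv_cancel_left₀ h0]
  rw [gradSq_eq hf, gradSq_eq hlog.differentiableAt]
  simp only [h, mul_pow, ← mul_add, ← Finset.mul_sum]
  ring

section RightHandSide

variable {ε : ℝ}

theorem approxRhs_pos (hk : 1 ≤ k) (hkn : k < n) (hε : 0 < ε) (z : EuclideanSpace ℂ (Fin n)) :
    0 < approxRhs k ε z := by
  have h1 : (0 : ℝ) < n.choose k := by exact_mod_cast Nat.choose_pos hkn.le
  have hk0 : (0 : ℝ) < k := by exact_mod_cast hk
  have h2 : 0 < (n : ℝ) / k - 1 := by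
    rw [sub_pos, one_lt_div hk0]
    exact_mod_cast hkn
  rw [approxRhs]
  positivity

theorem contDiff_approxRhs (hε : 0 < ε) :
    ContDiff ℝ ∞ (approxRhs (n := n) k ε) := by
  have h : ContDiff ℝ ∞ fun z : EuclideanSpace ℂ (Fin n) => (‖z‖ ^ 2 + ε ^ 2) ^ (n + 1) :=
    ((contDiff_norm_sq ℂ).add contDiff_const).pow _
  exact contDiff_const.mul (h.inv fun _ => by positivity)

theorem smoothNear_log_approxRhs (hk : 1 ≤ k) (hkn : k < n) (hε : 0 < ε)
    (z : EuclideanSpace ℂ (Fin n)) : SmoothNear (fun w => Real.log (approxRhs k ε w)) z :=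
  Eventually.of_forall fun _ =>
    ((contDiff_approxRhs hε).log fun y => (approxRhs_pos hk hkn hε y).ne').contDiffAt

theorem approxGreen_neg (hε : 0 < ε) (z : EuclideanSpace ℂ (Fin n)) : approxGreen k ε z < 0 := by
  rw [approxGreen, neg_lt_zero]
  positivity

theorem continuousAt_rhsQuotient (hk : 1 ≤ k) (hkn : k < n) (hε : 0 < ε)
    {u : EuclideanSpace ℂ (Fin n) → ℝ} {z : EuclideanSpace ℂ (Fin n)} (hu : SmoothNear u z)
    (hneg : u z < 0) : ContinuousAt (rhsQuotient k ε u) z :=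
  (continuousAt_const.mul
    (hu.contDiffAt.continuousAt.neg.rpow_const (Or.inl (by simpa using hneg.ne)))).mul
    (continuousAt_gradSq (smoothNear_log_approxRhs hk hkn hε z))

end RightHandSide

/-- A function whose complex Laplacian is positive has no local maximum. -/
theorem not_isLocalMax_of_hessianOp_one_pos {u : EuclideanSpace ℂ (Fin n) → ℝ}
    {z : EuclideanSpace ℂ (Fin n)} (hu : SmoothNear u z) (hpos : 0 < hessianOp 1 u z) :
    ¬ IsLocalMax u z := by
  intro hmax
  obtain ⟨b, l, hdiag⟩ := exists_basisChange_diagonal hu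
  set w := (basisChange b).symm z
  have hw : basisChange b w = z := (basisChange b).apply_symm_apply z
  rw [← hw] at hu hmax hpos
  have hv : SmoothNear (u ∘ basisChange b) w := hu.comp_continuousLinearEquiv _
  have hvmax : IsLocalMax (u ∘ basisChange b) w :=
    ((basisChange b).continuous.tendsto w).eventually hmax
  rw [← hessianOp_comp_basisChange b hu, hessianOp, hessianEigenvalues, hdiag,
    esymm_roots_charpoly_diagonal, elemSymm_one] at hpos
  refine hpos.not_ge (Finset.sum_nonpos fun i _ => ?_)
  have h1 := congrArg Complex.re (congrFun (congrFun hdiag i) i)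
  rw [complexHessian_apply hv, Matrix.diagonal_apply_eq, Complex.ofReal_re] at h1
  rw [← h1]
  have h2 := dirDeriv_dirDeriv_nonpos_of_isLocalMax hvmax hv (unitRe i)
  have h3 := dirDeriv_dirDeriv_nonpos_of_isLocalMax hvmax hv (unitIm i)
  simp [-Complex.ofReal_add, -Complex.ofReal_sub]
  linarith

section RingDomain

variable {Ω : Set (EuclideanSpace ℂ (Fin n))} {R : ℝ}

theorem isOpen_ringDomain : IsOpen (ringDomain Ω R) :=
  Metric.isOpen_ball.sdiff isClosed_closure

theorem isCompact_closure_ringDomain : IsCompact (closure (ringDomain Ω R)) :=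
  (Metric.isBounded_ball.subset Set.sdiff_subset).isCompact_closure

theorem frontier_ringDomain_subset :
    frontier (ringDomain Ω R) ⊆ frontier Ω ∪ Metric.sphere 0 R := by
  intro z hz
  rw [ringDomain, Set.sdiff_eq] at hz
  rcases frontier_inter_subset _ _ hz with h | h
  · exact Or.inr (Metric.frontier_ball_subset_sphere h.1)
  · rw [frontier_compl] at h
    exact Or.inl (frontier_closure_subset h.2)

theorem mem_frontier_or_mem_of_mem_closure {z : EuclideanSpace ℂ (Fin n)}
    (hz : z ∈ closure (ringDomain Ω R)) : z ∈ frontier (ringDomain Ω R) ∨ z ∈ ringDomain Ω R := by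
  rw [closure_eq_interior_union_frontier, isOpen_ringDomain.interior_eq] at hz
  exact hz.symm

/-- Otherwise the ball would equal `closure Ω` and be clopen, hence empty or the whole space by
connectedness. -/
theorem nonempty_ringDomain (hn : 0 < n) (h0 : (0 : EuclideanSpace ℂ (Fin n)) ∈ Ω)
    (hR : closure Ω ⊆ Metric.ball 0 R) : (ringDomain Ω R).Nonempty := by
  have hR0 : 0 < R := by simpa using hR (subset_closure h0)
  rw [Set.nonempty_iff_ne_empty]
  intro he
  have heq : closure Ω = Metric.ball 0 R := hR.antisymm (Set.sdiff_eq_empty.1 he)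
  have hclopen : IsClopen (Metric.ball (0 : EuclideanSpace ℂ (Fin n)) R) :=
    ⟨heq ▸ isClosed_closure, Metric.isOpen_ball⟩
  rcases isClopen_iff.1 hclopen with h | h
  · exact (Metric.nonempty_ball.2 hR0).ne_empty h
  · have : EuclideanSpace.single (⟨0, hn⟩ : Fin n) (R : ℂ) ∈
        Metric.ball (0 : EuclideanSpace ℂ (Fin n)) R := h ▸ Set.mem_univ _
    rw [mem_ball_zero_iff, PiLp.norm_single, Complex.norm_real, Real.norm_eq_abs] at this
    exact this.not_ge (le_abs_self R)

theorem nonempty_frontier_ringDomain (hn : 0 < n) (h0 : (0 : EuclideanSpace ℂ (Fin n)) ∈ Ω)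
    (hR : closure Ω ⊆ Metric.ball 0 R) : (frontier (ringDomain Ω R)).Nonempty := by
  rw [nonempty_frontier_iff]
  refine ⟨nonempty_ringDomain hn h0 hR, fun h => ?_⟩
  have : (0 : EuclideanSpace ℂ (Fin n)) ∈ ringDomain Ω R := h ▸ Set.mem_univ _
  exact this.2 (subset_closure h0)

end RingDomain

/-! ### Consequences of the maximum principle for solutions -/

namespace IsApproxSolution

variable {Ω : Set (EuclideanSpace ℂ (Fin n))} {R ε : ℝ} {u : EuclideanSpace ℂ (Fin n) → ℝ}

theorem smoothNear (hu : IsApproxSolution k Ω R ε u) {z : EuclideanSpace ℂ (Fin n)}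
    (hz : z ∈ closure (ringDomain Ω R)) : SmoothNear u z := by
  obtain ⟨U, hU, hsub, hcd⟩ := hu.smooth
  filter_upwards [hU.mem_nhds (hsub hz)] with w hw
  exact hcd.contDiffAt (hU.mem_nhds hw)

theorem neg_of_mem_frontier (hu : IsApproxSolution k Ω R ε u) (hε : 0 < ε)
    {z : EuclideanSpace ℂ (Fin n)} (hz : z ∈ frontier (ringDomain Ω R)) : u z < 0 := by
  rcases frontier_ringDomain_subset hz with h | h
  · rw [hu.inner_boundary z h]
    norm_num
  · rw [hu.outer_boundary z h]
    exact approxGreen_neg hε z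

/-- The boundary values are negative, and `S_1 > 0` excludes an interior maximum. -/
theorem neg (hu : IsApproxSolution k Ω R ε u) (hk : 1 ≤ k) (hε : 0 < ε)
    {z : EuclideanSpace ℂ (Fin n)} (hz : z ∈ closure (ringDomain Ω R)) : u z < 0 := by
  obtain ⟨y, hy, hmax⟩ := isCompact_closure_ringDomain.exists_isMaxOn ⟨z, hz⟩
    fun w hw => (hu.smoothNear hw).contDiffAt.continuousAt.continuousWithinAt
  refine (hmax hz).trans_lt ?_
  rcases mem_frontier_or_mem_of_mem_closure hy with h | h
  · exact hu.neg_of_mem_frontier hε h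
  · refine absurd ?_ (not_isLocalMax_of_hessianOp_one_pos (hu.smoothNear hy)
      (hu.subharmonic y h 1 le_rfl hk))
    exact hmax.isLocalMax (mem_of_superset (isOpen_ringDomain.mem_nhds h) subset_closure)

/-- At an interior maximum of the gradient quotient with nonzero gradient, the gradient quotient is
bounded by the quotient formed with the right-hand side. -/
theorem gradQuotient_le_rhsQuotient (hu : IsApproxSolution k Ω R ε u) (hk : 1 ≤ k) (hkn : k < n)
    (hε : 0 < ε) {z : EuclideanSpace ℂ (Fin n)} (hz : z ∈ ringDomain Ω R)
    (hmax : IsLocalMax (gradQuotient k u) z) (hG : 0 < gradSq u z) :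
    gradQuotient k u z ≤ rhsQuotient k ε u z := by
  have hneg := hu.neg hk hε (subset_closure hz)
  have hf := (contDiff_approxRhs (n := n) (k := k) hε).contDiffAt.differentiableAt (x := z) (by simp)
  have hfpos := approxRhs_pos hk hkn hε z
  have key := gradient_bound_of_isLocalMax hk hkn (hu.smoothNear (subset_closure hz)) hf
    (by filter_upwards [isOpen_ringDomain.mem_nhds hz] with w hw using hu.equation w hw)
    (hu.subharmonic z hz) hneg hmax hG
  rw [gradSq_log hf hfpos.ne', Real.sqrt_mul (sq_nonneg _), Real.sqrt_sq hfpos.le] at key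
  rw [gradQuotient, rhsQuotient]
  set L := gradSq (fun w => Real.log (approxRhs k ε w)) z
  set G := gradSq u z
  set f := approxRhs k ε z
  obtain ⟨t, ht⟩ : ∃ t, t = -u z := ⟨_, rfl⟩
  rw [← ht] at key ⊢
  have ht0 : 0 < t := by linarith
  have hk0 : (0 : ℝ) < k := by exact_mod_cast hk
  have hd0 : 0 < (n : ℝ) - k := sub_pos.2 (by exact_mod_cast hkn)
  have hn0 : 0 < 2 * (n : ℝ) - k := by linarith
  set p := (2 * (n : ℝ) - k) / ((n : ℝ) - k) with hp
  have hp0 : 0 < p := div_pos hn0 hd0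
  have h1 : p * k * √G ≤ 2 * t * √L := by
    refine le_of_mul_le_mul_left ?_ (div_pos hfpos ht0)
    calc f / t * (p * k * √G) = p * (k * f) / t * √G := by ring
      _ ≤ 2 * (f * √L) := key
      _ = _ := by field_simp
  have h2 : (p * k) ^ 2 * G ≤ (2 * t) ^ 2 * L := by
    have := pow_le_pow_left₀ (by positivity) h1 2
    rwa [mul_pow, mul_pow _ (√L), Real.sq_sqrt gradSq_nonneg, Real.sq_sqrt gradSq_nonneg] at this
  have h3 : 2 * ((n : ℝ) - k) / (k * (2 * n - k)) = 2 / (p * k) := by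
    rw [hp]
    field_simp
  -- The exponent is `2 - p`: the factor `t²` comes from squaring the gradient bound.
  have h4 : t ^ (-((k : ℝ) / (n - k))) = t ^ 2 * t ^ (-p) := by
    rw [← Real.rpow_two, ← Real.rpow_add ht0]
    congr 1
    rw [hp]
    field_simp
    ring_nf
  rw [h3, h4]
  have hr : 0 < t ^ (-p) := Real.rpow_pos_of_pos ht0 _
  calc G * t ^ (-p) = (p * k) ^ 2 * G * (t ^ (-p) / (p * k) ^ 2) := by field_simp
    _ ≤ (2 * t) ^ 2 * L * (t ^ (-p) / (p * k) ^ 2) :=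
        mul_le_mul_of_nonneg_right h2 (by positivity)
    _ = _ := by ring_nf

end IsApproxSolution

theorem exists_isGreatest_image {X : Type*} [TopologicalSpace X] {s : Set X} (hs : IsCompact s)
    (hne : s.Nonempty) {F : X → ℝ} (hF : ∀ x ∈ s, ContinuousAt F x) :
    ∃ x ∈ s, IsGreatest (F '' s) (F x) := by
  obtain ⟨x, hx, hmax⟩ := hs.exists_isMaxOn hne fun y hy => (hF y hy).continuousWithinAt
  exact ⟨x, hx, Set.mem_image_of_mem F hx, Set.forall_mem_image.2 fun y hy => hmax hy⟩

end

end KHessian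

end

theorem theorem4p3 (n k : ℕ) (hk : 1 ≤ k) (hkn : k < n)
    (Ω : Set (EuclideanSpace ℂ (Fin n))) (hΩ : IsOpen Ω)
    (h0 : (0 : EuclideanSpace ℂ (Fin n)) ∈ Ω)
    (R : ℝ) (hR : closure Ω ⊆ Metric.ball 0 R) (ε : ℝ) (hε : 0 < ε)
    (u : EuclideanSpace ℂ (Fin n) → ℝ) (hu : KHessian.IsApproxSolution k Ω R ε u) :
    (∀ z ∈ closure (KHessian.ringDomain Ω R), u z < 0) ∧
    ∃ M B Q : ℝ,
      IsGreatest (KHessian.gradQuotient k u '' closure (KHessian.ringDomain Ω R)) M ∧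
      IsGreatest (KHessian.gradQuotient k u '' frontier (KHessian.ringDomain Ω R)) B ∧
      IsGreatest (KHessian.rhsQuotient k ε u '' closure (KHessian.ringDomain Ω R)) Q ∧
      M ≤ max B Q := by
  have hneg : ∀ z ∈ closure (KHessian.ringDomain Ω R), u z < 0 := fun z hz => hu.neg hk hε hz
  have hn : 0 < n := by omega
  have hcompact := KHessian.isCompact_closure_ringDomain (Ω := Ω) (R := R)
  have hne := (KHessian.nonempty_ringDomain hn h0 hR).closure
  have hquot : ∀ z ∈ closure (KHessian.ringDomain Ω R),
      ContinuousAt (KHessian.gradQuotient k u) z := fun z hz =>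
    KHessian.continuousAt_gradQuotient (hu.smoothNear hz) (hneg z hz)
  obtain ⟨x, hx, hM⟩ := KHessian.exists_isGreatest_image hcompact hne hquot
  obtain ⟨y, hy, hB⟩ := KHessian.exists_isGreatest_image
    (hcompact.of_isClosed_subset isClosed_frontier frontier_subset_closure)
    (KHessian.nonempty_frontier_ringDomain hn h0 hR)
    fun z hz => hquot z (frontier_subset_closure hz)
  obtain ⟨q, hq, hQ⟩ := KHessian.exists_isGreatest_image hcompact hne fun z hz =>
    KHessian.continuousAt_rhsQuotient hk hkn hε (hu.smoothNear hz) (hneg z hz)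
  refine ⟨hneg, _, _, _, hM, hB, hQ, ?_⟩
  rcases KHessian.mem_frontier_or_mem_of_mem_closure hx with h | h
  · exact le_max_of_le_left (hB.2 (Set.mem_image_of_mem _ h))
  · rcases (KHessian.gradSq_nonneg (v := u) (w := x)).eq_or_lt with hG | hG
    -- If the gradient vanishes at the maximum point then `M = 0`, which the nonnegative boundary
    -- maximum dominates.
    · refine le_max_of_le_left ?_
      rw [KHessian.gradQuotient, ← hG, zero_mul]
      exact KHessian.gradQuotient_nonneg (hneg y (frontier_subset_closure hy)).le
    · refine le_max_of_le_right ((hu.gradQuotient_le_rhsQuotient hk hkn hε h ?_ hG).trans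
        (hQ.2 (Set.mem_image_of_mem _ hx)))
      filter_upwards [KHessian.isOpen_ringDomain.mem_nhds h] with w hw
      exact hM.2 (Set.mem_image_of_mem _ (subset_closure hw))
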